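/- **Setting.** Let $\mathbb{E}$ be a finite-dimensional real vector space with dual space $\mathbb{E}^*$, let $K\subset\mathbb{E}$ be a closed convex cone containing no straight line, $K^*=\{s\in\mathbb{E}^*:\langle s,x\rangle\ge 0\ \ \forall x\in K\}$, $A:\mathbb{E}\to\mathbb{R}^m$ linear with adjoint $A^*:\mathbb{R}^m\to\mathbb{E}^*$, $b\in\mathbb{R}^m\setminus\{0\}$, $c\in\mathbb{E}^*$. Consider $$f^*=\min\{\langle c,x\rangle:\ x\in K,\ Ax=b\},\qquad \max\{\langle b,y\rangle:\ s+A^*y=c,\ s\in K^*,\ y\in\mathbb{R}^m\}.$$ Assume that $(y,\tau)\mapsto A^*y+\tau c$ is injective on $\mathbb{R}^{m+1}$, and that there is $(\tilde x,\tilde y,\tilde s)\in \operatorname{int}K\times\mathbb{R}^m\times\operatorname{int}K^*$ with $A\tilde x=b$, $\tilde s+A^*\tilde y=c$ (a *strictly feasible* point). Let $F$ be a regular barrier for $K$ with parameter $\nu\ge1$: $F$ is closed, convex and $C^3$ with domain $\operatorname{int}K$, and $D^3F(x)[h]^3\le 2(D^2F(x)[h]^2)^{3/2}$, $\langle\nabla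 F(x),h\rangle^2\le\nu\langle\nabla^2F(x)h,h\rangle$, $F(\tau x)=F(x)-\nu\ln\tau$ for all $x\in\operatorname{int}K$, $h\in\mathbb{E}$, $\tau>0$. Let $F_*(s)=\max_{x\in\operatorname{int}K}[-\langle s,x\rangle-F(x)]$ for $s\in\operatorname{int}K^*$, $\zeta(y)=F_*(c-A^*y)$, $\psi_t(y)=\zeta(y)-t\langle b,y\rangle$, $\|g\|_y=\langle g,[\nabla^2\zeta(y)]^{-1}g\rangle^{1/2}$, $\omega_*(\tau)=-\tau-\ln(1-\tau)$, and, for strictly feasible $z=(x,y,s)$, $$\Omega(z)=\nu\ln\langle s,x\rangle+F(x)+F_*(s)+\nu-\nu\ln\nu .$$ For $\epsilon>0$, an *$\epsilon$-solution* is a triple $(x,y,s)$ with $x\in K$, $Ax=b$, $s\in K^*$, $s+A^*y=c$ and $\langle c,x\rangle-\langle b,y\rangle\le\epsilon$. **Method.** Let $\beta\in(0,\frac14]$, $\delta>0$ with $\varkappa:=\frac{\delta}{1+\delta}-\frac{\beta(2+\beta)}{1-\beta}>0$. Let $y_0$ satisfy $c-A^*y_0\in\operatorname{int}K^*$ and $\|\nabla\zeta(y_0)\|_{y_0}\le\frac12\beta$,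 and put $t_0=\beta/(2\|b\|_{y_0})$. At iteration $k\ge0$ let $d_k=[\nabla^2\zeta(y_k)]^{-1}\nabla\psi_{t_k}(y_k)$, $\lambda_k=\|\nabla\psi_{t_k}(y_k)\|_{y_k}$, $s_k=c-A^*y_k$. * If $\lambda_k>\beta$ (correction): $y_{k+1}=y_k-\frac{d_k}{1+\lambda_k}$, $t_{k+1}=t_k$. * If $\lambda_k\le\beta$ (*predicting iteration*): set $w^*_k=t_k^{1/2}s_k$, $\hat y_k=y_k+d_k$, $\hat s_k=c-A^*\hat y_k$, $\hat x_k=\nabla^2F_*(w^*_k)\hat s_k$, $\hat z_k=(\hat x_k,\hat y_k,\hat s_k)$; let $\Delta z_k=(\Delta x_k,\Delta y_k,\Delta s_k)$ solve $\Delta x_k+\nabla^2F_*(w^*_k)\Delta s_k=-\hat x_k$, $A\Delta x_k=0$, $\Delta s_k+A^*\Delta y_k=0$; let $\alpha_k>0$ be any number such that $z_{k+1}=\hat z_k+\alpha_k\Delta z_k=(x_{k+1},y_{k+1},s_{k+1})$ is strictly feasible and $\Omega(z_{k+1})=\delta+\omega_*\!\left(\frac{2\beta}{(1-\beta)^2}\right)$;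 its $y$-part is $y_{k+1}$, and $t_{k+1}=\nu/\langle s_{k+1},x_{k+1}\rangle$. **Statement.** Assume that the dual feasible set $\{y: c-A^*y\in K^*\}$ is bounded. Then there is a unique $y^*_\zeta$ (the analytic center) with $c-A^*y^*_\zeta\in\operatorname{int}K^*$ and $\nabla\zeta(y^*_\zeta)=0$. For any $\epsilon>0$ put $$X=\frac{\sqrt\nu+\beta}{(1-\beta)\varkappa}\cdot\ln\left(\frac2\epsilon\,[f^*-\langle b,y^*_\zeta\rangle]\,\frac{(\beta+\sqrt\nu)^2}{\beta(1-\beta)}\right),\qquad N=\max\{1,\lceil X\rceil\}.$$ Then for every finite run of the method that contains at least $N$ predicting iterations, one of its first $N$ predicting iterations $k$ generates an $\epsilon$-solution (namely $\hat z_k$ or $z_{k+1}$). Moreover, every infinite run of the method contains infinitely many predicting iterations. Thus an infinite run always generates an $\epsilon$-solution in at most $N$ predicting iterations. -/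

import Mathlib

open Filter Topology
open scoped InnerProductSpace

noncomputable section

/-! ### Derivatives, local norms and self-concordant barriers -/

/-- The Hessian `∇² f(x)`, a linear operator from `V` to the dual space of `V`. -/
def hess {V : Type*} [NormedAddCommGroup V] [NormedSpace ℝ V] (f : V → ℝ) (x : V) :
    V →L[ℝ] StrongDual ℝ V :=
  fderiv ℝ (fderiv ℝ f) x

/-- The norm `⟨g, H⁻¹ g⟩^{1/2}` of a linear function `g`, for a positive definite operator `H`
from `V` to its dual space. -/
def dualLocalNorm {V : Type*} [NormedAddCommGroup V] [NormedSpace ℝ V]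
    (H : V →L[ℝ] StrongDual ℝ V) (g : StrongDual ℝ V) : ℝ :=
  Real.sqrt (g (H.inverse g))

/-- `f` is a self-concordant function with open domain `U` (values of `f` outside `U` are
irrelevant). The field `closed` says that the epigraph of `f` is closed, i.e. `f` tends to `+∞`
at every boundary point of its open domain. -/
structure IsSelfConcordant {V : Type*} [NormedAddCommGroup V] [NormedSpace ℝ V]
    (U : Set V) (f : V → ℝ) : Prop where
  isOpen : IsOpen U
  convex : ConvexOn ℝ U f
  smooth : ContDiffOn ℝ 3 f U
  closed : ∀ x ∈ frontier U, Tendsto f (𝓝[U] x) atTop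
  third_le : ∀ x ∈ U, ∀ h : V,
    iteratedFDeriv ℝ 3 f x (fun _ => h) ≤ 2 * (hess f x h h) ^ (3 / 2 : ℝ)

/-- `f` is a self-concordant barrier with parameter `ν` and open domain `U`. -/
structure IsSelfConcordantBarrier {V : Type*} [NormedAddCommGroup V] [NormedSpace ℝ V]
    (U : Set V) (f : V → ℝ) (ν : ℝ) : Prop extends IsSelfConcordant U f where
  one_le : 1 ≤ ν
  barrier : ∀ x ∈ U, ∀ h : V, (fderiv ℝ f x h) ^ 2 ≤ ν * hess f x h h

/-- `F` is a regular (`ν`-normal) barrier for the cone `K`: a self-concordant barrier with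
parameter `ν` and domain `int K`, logarithmically homogeneous of degree `ν`. -/
structure IsRegularBarrier {V : Type*} [NormedAddCommGroup V] [NormedSpace ℝ V]
    (K : ProperCone ℝ V) (F : V → ℝ) (ν : ℝ) : Prop
    extends IsSelfConcordantBarrier (interior (K : Set V)) F ν where
  log_homogeneous : ∀ x ∈ interior (K : Set V), ∀ τ : ℝ, 0 < τ →
    F (τ • x) = F x - ν * Real.log τ

/-- The dual function `s ↦ max_{x ∈ U} [-⟨s, x⟩ - f(x)]` of a function `f` with domain `U`. -/
def fenchelDual {V : Type*} [NormedAddCommGroup V] [NormedSpace ℝ V]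
    (U : Set V) (f : V → ℝ) (s : StrongDual ℝ V) : ℝ :=
  ⨆ x : U, (-(s x) - f x)

/-- `ω_*(τ) = -τ - ln(1 - τ)`. -/
def omegaStar (τ : ℝ) : ℝ := -τ - Real.log (1 - τ)

/-! ### The primal-dual pair of conic problems -/

/-- The space of primal-dual points `z = (x, y, s)`. -/
abbrev PDPoint (E : Type*) [NormedAddCommGroup E] [NormedSpace ℝ E] (m : ℕ) : Type _ :=
  E × EuclideanSpace ℝ (Fin m) × StrongDual ℝ E

/-- Data of the pair of problems
`min {⟨c, x⟩ : x ∈ K, A x = b}` and `max {⟨b, y⟩ : s + A^* y = c, s ∈ K^*}`.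
The bundled `cone` is a nonempty closed convex cone; that it contains no line is required in
`ConicProblem.Standing`. -/
structure ConicProblem (E : Type*) [NormedAddCommGroup E] [NormedSpace ℝ E] (m : ℕ) where
  cone : ProperCone ℝ E
  A : E →L[ℝ] EuclideanSpace ℝ (Fin m)
  b : EuclideanSpace ℝ (Fin m)
  c : StrongDual ℝ E

namespace ConicProblem

variable {E : Type*} [NormedAddCommGroup E] [NormedSpace ℝ E] {m : ℕ}

/-- The adjoint operator `A^*`: `⟨A^* y, x⟩ = ⟨A x, y⟩`. -/
def adj (P : ConicProblem E m) (y : EuclideanSpace ℝ (Fin m)) : StrongDual ℝ E :=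
  (innerSL ℝ y).comp P.A

/-- The dual slack `c - A^* y`. -/
def slack (P : ConicProblem E m) (y : EuclideanSpace ℝ (Fin m)) : StrongDual ℝ E :=
  P.c - P.adj y

/-- The dual cone `K^* = {s : ⟨s, x⟩ ≥ 0 for all x ∈ K}`. -/
def dualCone [FiniteDimensional ℝ E] (P : ConicProblem E m) : ProperCone ℝ (StrongDual ℝ E) :=
  ProperCone.dual (topDualPairing ℝ E).flip (P.cone : Set E)

/-- The primal optimal value `f^*`. -/
def primalValue (P : ConicProblem E m) : ℝ :=
  sInf (P.c '' {x : E | x ∈ P.cone ∧ P.A x = P.b})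

/-- The dual feasible set `F_y = {y : c - A^* y ∈ K^*}`. -/
def dualFeasible [FiniteDimensional ℝ E] (P : ConicProblem E m) :
    Set (EuclideanSpace ℝ (Fin m)) :=
  {y | P.slack y ∈ P.dualCone}

/-- Feasible primal-dual points. -/
def Feasible [FiniteDimensional ℝ E] (P : ConicProblem E m) (z : PDPoint E m) : Prop :=
  z.1 ∈ P.cone ∧ P.A z.1 = P.b ∧ z.2.2 ∈ P.dualCone ∧ z.2.2 + P.adj z.2.1 = P.c

/-- Strictly feasible primal-dual points. -/
def StrictlyFeasible [FiniteDimensional ℝ E] (P : ConicProblem E m) (z : PDPoint E m) : Prop :=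
  z.1 ∈ interior (P.cone : Set E) ∧ P.A z.1 = P.b ∧
    z.2.2 ∈ interior (P.dualCone : Set (StrongDual ℝ E)) ∧ z.2.2 + P.adj z.2.1 = P.c

/-- An `ε`-solution: a feasible primal-dual point with duality gap at most `ε`. -/
def IsEpsSolution [FiniteDimensional ℝ E] (P : ConicProblem E m) (ε : ℝ) (z : PDPoint E m) :
    Prop :=
  P.Feasible z ∧ P.c z.1 - ⟪P.b, z.2.1⟫_ℝ ≤ ε

/-- The standing assumptions on the pair of problems: `K` contains no straight line, `b ≠ 0`,
the extended operator `(A^*, c)` has full column rank, and there is a strictly feasible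
primal-dual point. -/
structure Standing [FiniteDimensional ℝ E] (P : ConicProblem E m) : Prop where
  no_line : ∀ x : E, x ∈ P.cone → -x ∈ P.cone → x = 0
  b_ne : P.b ≠ 0
  full_rank : Function.Injective
    (fun p : EuclideanSpace ℝ (Fin m) × ℝ => P.adj p.1 + p.2 • P.c)
  strict : ∃ z : PDPoint E m, P.StrictlyFeasible z

/-! ### Barriers and the proximity measure -/

/-- The dual barrier `F_*`. -/
def dualBarrier (P : ConicProblem E m) (F : E → ℝ) (s : StrongDual ℝ E) : ℝ :=
  fenchelDual (interior (P.cone : Set E)) F s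

/-- The barrier `ζ(y) = F_*(c - A^* y)` of the dual feasible set. -/
def zeta (P : ConicProblem E m) (F : E → ℝ) (y : EuclideanSpace ℝ (Fin m)) : ℝ :=
  P.dualBarrier F (P.slack y)

/-- The penalty function `ψ_t(y) = ζ(y) - t ⟨b, y⟩`. -/
def psi (P : ConicProblem E m) (F : E → ℝ) (t : ℝ) (y : EuclideanSpace ℝ (Fin m)) : ℝ :=
  P.zeta F y - t * ⟪P.b, y⟫_ℝ

/-- `y` is an analytic center of the dual feasible set: an interior point with `∇ζ(y) = 0`. -/
def IsAnalyticCenter [FiniteDimensional ℝ E] (P : ConicProblem E m) (F : E → ℝ)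
    (y : EuclideanSpace ℝ (Fin m)) : Prop :=
  P.slack y ∈ interior (P.dualCone : Set (StrongDual ℝ E)) ∧ fderiv ℝ (P.zeta F) y = 0

/-- The functional proximity measure
`Ω(z) = ν ln ⟨s, x⟩ + F(x) + F_*(s) + ν - ν ln ν`. -/
def Omega (P : ConicProblem E m) (F : E → ℝ) (ν : ℝ) (z : PDPoint E m) : ℝ :=
  ν * Real.log (z.2.2 z.1) + F z.1 + P.dualBarrier F z.2.2 + ν - ν * Real.log ν

/-- The Newton direction `d = [∇²ζ(y)]⁻¹ ∇ψ_t(y)`. -/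
def newtonDir (P : ConicProblem E m) (F : E → ℝ) (t : ℝ) (y : EuclideanSpace ℝ (Fin m)) :
    EuclideanSpace ℝ (Fin m) :=
  (hess (P.zeta F) y).inverse (fderiv ℝ (P.psi F t) y)

/-- The Newton decrement `λ = ⟨∇ψ_t(y), [∇²ζ(y)]⁻¹ ∇ψ_t(y)⟩^{1/2}`. -/
def newtonDec (P : ConicProblem E m) (F : E → ℝ) (t : ℝ) (y : EuclideanSpace ℝ (Fin m)) : ℝ :=
  dualLocalNorm (hess (P.zeta F) y) (fderiv ℝ (P.psi F t) y)

end ConicProblem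

/-! ### The predictor-corrector method -/

/-- The sequences produced by the method. The entries `zhat k`, `dz k`, `alpha k` are relevant
only when iteration `k` is a predicting one. -/
structure Trace (E : Type*) [NormedAddCommGroup E] [NormedSpace ℝ E] (m : ℕ) where
  y : ℕ → EuclideanSpace ℝ (Fin m)
  t : ℕ → ℝ
  zhat : ℕ → PDPoint E m
  dz : ℕ → PDPoint E m
  alpha : ℕ → ℝ

namespace Trace

variable {E : Type*} [NormedAddCommGroup E] [NormedSpace ℝ E] {m : ℕ}

/-- The point `z_{k+1} = ẑ_k + α_k Δz_k` produced by a predicting iteration `k`. -/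
def znext (T : Trace E m) (k : ℕ) : PDPoint E m := T.zhat k + T.alpha k • T.dz k

/-- The Newton decrement `λ_k`. -/
def lam (T : Trace E m) (P : ConicProblem E m) (F : E → ℝ) (k : ℕ) : ℝ :=
  P.newtonDec F (T.t k) (T.y k)

/-- The number of predicting iterations (those with `λ_j ≤ β`) among the iterations
`0, …, k - 1`. -/
def predCount (T : Trace E m) (P : ConicProblem E m) (F : E → ℝ) (β : ℝ) (k : ℕ) : ℕ :=
  ((Finset.range k).filter (fun j => T.lam P F j ≤ β)).card

/-- `T` records `n` iterations (numbered `0, …, n - 1`) of the general predictor-corrector method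
with dual gambit step, with parameters `β`, `δ` and starting point `y₀`.
Points of `E` are identified with linear functions on the dual space, so that an equation
`x = ∇²F_*(w) s` in `E` reads `⟨u, x⟩ = ∇²F_*(w)[s, u]` for all `u` in the dual space. -/
structure IsRun [FiniteDimensional ℝ E] (T : Trace E m) (P : ConicProblem E m) (F : E → ℝ)
    (ν β δ : ℝ) (y₀ : EuclideanSpace ℝ (Fin m)) (n : ℕ) : Prop where
  y_zero : T.y 0 = y₀
  t_zero : T.t 0 = β / (2 * dualLocalNorm (hess (P.zeta F) y₀) (innerSL ℝ P.b))
  /-- Damped Newton step. -/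
  newton : ∀ k < n, β < T.lam P F k →
    T.y (k + 1) = T.y k - (1 / (1 + T.lam P F k)) • P.newtonDir F (T.t k) (T.y k) ∧
    T.t (k + 1) = T.t k
  /-- Dual gambit rule: `ŷ_k = y_k + d_k`, `ŝ_k = c - A^* ŷ_k` and
  `x̂_k = ∇²F_*(w_k^*) ŝ_k`, where `w_k^* = t_k^{1/2} s_k`, `s_k = c - A^* y_k`. -/
  gambit : ∀ k < n, T.lam P F k ≤ β →
    (T.zhat k).2.1 = T.y k + P.newtonDir F (T.t k) (T.y k) ∧
    (T.zhat k).2.2 = P.slack (T.zhat k).2.1 ∧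
    ∀ u : StrongDual ℝ E, u (T.zhat k).1 =
      hess (P.dualBarrier F) (Real.sqrt (T.t k) • P.slack (T.y k)) (T.zhat k).2.2 u
  /-- Affine-scaling direction: `Δx_k + ∇²F_*(w_k^*) Δs_k = -x̂_k`, `A Δx_k = 0`,
  `Δs_k + A^* Δy_k = 0`. -/
  direction : ∀ k < n, T.lam P F k ≤ β →
    (∀ u : StrongDual ℝ E, u (T.dz k).1 +
      hess (P.dualBarrier F) (Real.sqrt (T.t k) • P.slack (T.y k)) (T.dz k).2.2 u =
        -u (T.zhat k).1) ∧
    P.A (T.dz k).1 = 0 ∧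
    (T.dz k).2.2 + P.adj (T.dz k).2.1 = 0
  /-- The step size is any positive solution of `Ω(ẑ_k + α_k Δz_k) = δ + ω_*(2β / (1 - β)²)`,
  the point `ẑ_k + α_k Δz_k` being in the domain of `Ω`. -/
  step : ∀ k < n, T.lam P F k ≤ β →
    0 < T.alpha k ∧ P.StrictlyFeasible (T.znext k) ∧
    P.Omega F ν (T.znext k) = δ + omegaStar (2 * β / (1 - β) ^ 2)
  /-- `y_{k+1}` is the `y`-part of `z_{k+1}` and `t_{k+1} = ν / ⟨s_{k+1}, x_{k+1}⟩`. -/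
  update : ∀ k < n, T.lam P F k ≤ β →
    T.y (k + 1) = (T.znext k).2.1 ∧
    T.t (k + 1) = ν / (T.znext k).2.2 (T.znext k).1

end Trace

/-! ### The complexity bound -/

/-- `ϰ(β, δ) = δ / (1 + δ) - β (2 + β) / (1 - β)`. -/
def kappa (β δ : ℝ) : ℝ := δ / (1 + δ) - β * (2 + β) / (1 - β)

/-- The bound
`(√ν + β) / ((1 - β) ϰ) · ln ((2 / ε) · gap · (β + √ν)² / (β (1 - β)))`. -/
def predBound (ν β δ ε gap : ℝ) : ℝ :=
  (Real.sqrt ν + β) / ((1 - β) * kappa β δ) *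
    Real.log (2 / ε * gap * ((β + Real.sqrt ν) ^ 2 / (β * (1 - β))))

end

/-!
A predicting iteration multiplies the penalty parameter `t` by at least
`exp ((1 - β) ϰ / (√ν + β))`, corrections leave it unchanged, and the gap at `z_{k+1}` is
`ν / t_{k+1}`; so the method has an `ε`-solution as soon as `t ≥ ν / ε`, and the bound `N` only
counts how many such factors lead there from `t₀ = β / (2 ‖b‖_{y₀})`.

*Self-concordance through function values.* A self-concordant function satisfies
`f x + ⟨∇f x, h⟩ + ω(‖h‖_x) ≤ f (x + h) ≤ f x + ⟨∇f x, h⟩ + ω_*(‖h‖_x)`, the upper bound together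
with `x + h ∈ dom f` for `‖h‖_x < 1`. The structure `SelfConcordantModel` records these facts, and
they suffice for the whole argument. They are integrated from a one-dimensional differential
inequality for `F` (`IsRegularBarrier.model`). They pass to `F_*` by Fenchel duality of `ω` and
`ω_*`, without third derivatives of `F_*` (`ConicProblem.dualBarrier_model`), and then to `ζ` and
`ψ_t` by restriction to an affine subspace. They also give the decrease by `ω(λ)` of the damped
Newton step and the existence and uniqueness of critical points. The Hessian of `F_*` is identified
with the inverse of the Hessian of `F` by the inverse function theorem.

*The predictor* (`ConicProblem.mul_exp_rate_le`). Let `x = x(s_k)` be the maximizer defining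
`F_*(s_k)` and `B = ∇²F(x)`. In the metric of `B` the two parts of the affine-scaling direction are
orthogonal and their squared lengths sum up to `R² = t ⟨ŝ, x̂⟩ ≤ (√ν + β)²`, while the gap is
`(1 - α) R² / t`. Expanding both barriers at `x` and `s_k`, the first-order terms cancel against
the logarithm of the gap, and `Ω(z_{k+1}) = δ + ω_*(2 β / (1 - β)²)` forces
`α ≥ (1 - β) / (√ν + β) · δ / (1 + δ)`. The term subtracted in `ϰ` pays for
`R² / ν ≤ (1 + β / √ν)²`.

*The starting point.* The Dikin ellipsoid at `y₀` is dual feasible, hence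
`‖b‖_{y₀} ≤ f^* - ⟨b, y₀⟩` by weak duality; and `y₀` is at local distance at most `β` from the
analytic center. Together, `(1 - β) ‖b‖_{y₀}` is at most the gap at the analytic center
(`ConicProblem.one_sub_mul_dualLocalNorm_b_le`).

*Correction phases* are finite, because each correction decreases `ψ_t` by at least `ω(β)`, and
`ψ_t` is bounded below by any strictly feasible primal point.
-/

/-! ### Scalar inequalities -/

/-- `ω(r) = r - ln(1 + r)`, the convex conjugate of `ω_*`. -/
noncomputable def omegaLow (r : ℝ) : ℝ := r - Real.log (1 + r)

lemma log_le_half_sub_inv {u : ℝ} (hu : 1 ≤ u) : Real.log u ≤ (u - u⁻¹) / 2 := by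
  have h := Real.self_le_sinh_iff.2 (Real.log_nonneg hu)
  rwa [Real.sinh_log (by linarith)] at h

lemma omegaStar_le {τ : ℝ} (h0 : 0 ≤ τ) (h1 : τ < 1) :
    omegaStar τ ≤ τ ^ 2 / (2 * (1 - τ)) := by
  have h : 0 < 1 - τ := by linarith
  have := log_le_half_sub_inv (u := (1 - τ)⁻¹) (by rw [one_le_inv₀ h]; linarith)
  rw [Real.log_inv, inv_inv] at this
  unfold omegaStar
  have e : τ ^ 2 / (2 * (1 - τ)) = ((1 - τ)⁻¹ - (1 - τ)) / 2 - τ := by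
    field_simp
    ring
  linarith

lemma half_sq_le_omegaStar {τ : ℝ} (h0 : 0 ≤ τ) (h1 : τ < 1) : τ ^ 2 / 2 ≤ omegaStar τ := by
  have h : 0 < 1 - τ := by linarith
  have h2 := Real.le_log_one_add_of_nonneg (x := τ / (1 - τ)) (by positivity)
  have e1 : 1 + τ / (1 - τ) = (1 - τ)⁻¹ := by field_simp; ring
  have e2 : 2 * (τ / (1 - τ)) / (τ / (1 - τ) + 2) = 2 * τ / (2 - τ) := by
    have : (τ / (1 - τ) + 2) = (2 - τ) / (1 - τ) := by field_simp; ring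
    have h3 : 0 < 2 - τ := by linarith
    rw [this]; field_simp
  rw [e1, e2, Real.log_inv] at h2
  have e3 : τ + τ ^ 2 / 2 ≤ 2 * τ / (2 - τ) := by
    rw [le_div_iff₀ (by linarith)]
    nlinarith [pow_nonneg h0 3]
  unfold omegaStar
  linarith

lemma omegaStar_mono {a b : ℝ} (h0 : 0 ≤ a) (hab : a ≤ b) (h1 : b < 1) :
    omegaStar a ≤ omegaStar b := by
  have hb : 0 < 1 - b := by linarith
  have ha : 0 < 1 - a := by linarith
  have h := Real.log_le_sub_one_of_pos (x := (1 - b) / (1 - a)) (by positivity)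
  rw [Real.log_div hb.ne' ha.ne'] at h
  have e : (1 - b) / (1 - a) - 1 ≤ -(b - a) := by
    rw [div_sub_one ha.ne', div_le_iff₀ ha]
    nlinarith
  unfold omegaStar
  linarith

lemma omegaLow_ge {r : ℝ} (h0 : 0 ≤ r) : r ^ 2 / (2 * (1 + r)) ≤ omegaLow r := by
  have h : 0 < 1 + r := by linarith
  have := log_le_half_sub_inv (u := 1 + r) (by linarith)
  have e : r ^ 2 / (2 * (1 + r)) = r - ((1 + r) - (1 + r)⁻¹) / 2 := by
    field_simp
    ring
  unfold omegaLow
  linarith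

lemma omegaLow_nonneg {r : ℝ} (h0 : 0 ≤ r) : 0 ≤ omegaLow r :=
  le_trans (by positivity) (omegaLow_ge h0)

lemma omegaLow_pos {r : ℝ} (h0 : 0 < r) : 0 < omegaLow r :=
  lt_of_lt_of_le (by positivity) (omegaLow_ge h0.le)

lemma omegaLow_mono {a b : ℝ} (h0 : 0 ≤ a) (hab : a ≤ b) : omegaLow a ≤ omegaLow b := by
  have h := Real.log_le_sub_one_of_pos (x := (1 + b) / (1 + a))
    (div_pos (by linarith) (by linarith))
  rw [Real.log_div (by linarith) (by linarith)] at h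
  have e : (1 + b) / (1 + a) - 1 ≤ b - a := by
    rw [div_sub_one (by linarith), div_le_iff₀ (by linarith)]
    nlinarith
  unfold omegaLow
  linarith

/-- The Fenchel inequality for the conjugate pair `ω`, `ω_*`. -/
lemma mul_le_omegaLow_add_omegaStar {r l : ℝ} (hr : 0 ≤ r) (hl : l < 1) :
    l * r ≤ omegaLow r + omegaStar l := by
  have h1 : 0 < 1 + r := by linarith
  have h2 : 0 < 1 - l := by linarith
  have h := Real.log_le_sub_one_of_pos (mul_pos h1 h2)
  rw [Real.log_mul h1.ne' h2.ne'] at h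
  unfold omegaLow omegaStar
  linarith

/-- Equality in the Fenchel inequality at `l = r / (1 + r)`. -/
lemma omegaStar_div_one_add {r : ℝ} (hr : 0 ≤ r) :
    omegaStar (r / (1 + r)) = r / (1 + r) * r - omegaLow r := by
  have h1 : 0 < 1 + r := by linarith
  have e : 1 - r / (1 + r) = (1 + r)⁻¹ := by field_simp; ring
  unfold omegaLow omegaStar
  rw [e, Real.log_inv]
  field_simp
  ring

/-- If `ω(r) ≤ l r - ω(l)` with small `l`, then `r ≤ 2 l`. -/
lemma le_two_mul_of_omegaLow_le {r l : ℝ} (hl : 0 < l) (hl' : l ≤ 1 / 8)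
    (h : omegaLow r ≤ l * r - omegaLow l) (hr : 0 ≤ r) : r ≤ 2 * l := by
  by_contra! hc
  -- the tangent inequality for `ω` at `2 l`
  have h1 := Real.log_le_sub_one_of_pos (x := (1 + r) / (1 + 2 * l)) (by positivity)
  rw [Real.log_div (by linarith) (by linarith)] at h1
  have h2 := omegaLow_ge hl.le
  have h3 := omegaLow_ge (r := 2 * l) (by linarith)
  have e : (1 + r) / (1 + 2 * l) - 1 = (r - 2 * l) / (1 + 2 * l) := by field_simp; ring
  have h4 : omegaLow (2 * l) + (r - 2 * l) * (2 * l / (1 + 2 * l)) ≤ omegaLow r := by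
    have : (r - 2 * l) * (2 * l / (1 + 2 * l)) = (r - 2 * l) - (r - 2 * l) / (1 + 2 * l) := by
      field_simp; ring
    unfold omegaLow at *
    rw [e] at h1
    linarith
  have h5 : l ≤ 2 * l / (1 + 2 * l) := by
    rw [le_div_iff₀ (by linarith)]; nlinarith
  have h6 : (r - 2 * l) * l ≤ (r - 2 * l) * (2 * l / (1 + 2 * l)) :=
    mul_le_mul_of_nonneg_left h5 (by linarith)
  have h7 : 2 * l ^ 2 < l ^ 2 / (2 * (1 + l)) + (2 * l) ^ 2 / (2 * (1 + 2 * l)) := by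
    rw [div_add_div _ _ (by positivity) (by positivity), lt_div_iff₀ (by positivity)]
    have : 0 < l ^ 2 := by positivity
    nlinarith [mul_pos this hl, mul_pos (mul_pos this hl) hl]
  nlinarith

/-! ### Self-concordance on a line -/

/-- A function with nonnegative second derivative and zero value and slope at `0` is nonnegative. -/
lemma nonneg_of_second_deriv_nonneg {D D1 D2 : ℝ → ℝ} {a : ℝ} (ha : 0 ≤ a)
    (h1 : ∀ t ∈ Set.Icc 0 a, HasDerivAt D (D1 t) t)
    (h2 : ∀ t ∈ Set.Icc 0 a, HasDerivAt D1 (D2 t) t)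
    (hpos : ∀ t ∈ Set.Icc 0 a, 0 ≤ D2 t) (e0 : D 0 = 0) (e1 : D1 0 = 0) : 0 ≤ D a := by
  have key : ∀ {G G1 : ℝ → ℝ}, (∀ t ∈ Set.Icc 0 a, HasDerivAt G (G1 t) t) →
      (∀ t ∈ Set.Icc 0 a, 0 ≤ G1 t) → G 0 = 0 → ∀ t ∈ Set.Icc 0 a, 0 ≤ G t := by
    intro G G1 h hG e t ht
    have hm : MonotoneOn G (Set.Icc 0 a) := by
      refine monotoneOn_of_deriv_nonneg (convex_Icc 0 a)
        (fun x hx => (h x hx).continuousAt.continuousWithinAt)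
        (fun x hx => (h x (interior_subset hx)).differentiableAt.differentiableWithinAt)
        (fun x hx => ?_)
      rw [(h x (interior_subset hx)).deriv]
      exact hG x (interior_subset hx)
    have := hm (Set.left_mem_Icc.2 ha) ht ht.1
    linarith
  exact key h1 (key h2 hpos e1) e0 a (Set.right_mem_Icc.2 ha)

/-- The functions `(u + e)^{-1/2}` are `1`-Lipschitz if `|u'| ≤ 2 u^{3/2}`. The shift by `e > 0`
makes the estimate insensitive to zeros of `u`. -/
lemma abs_inv_sqrt_sub_le {u u' : ℝ → ℝ} {a : ℝ} (ha : 0 ≤ a)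
    (hu : ∀ t ∈ Set.Icc 0 a, HasDerivAt u (u' t) t) (h0 : ∀ t ∈ Set.Icc 0 a, 0 ≤ u t)
    (hb : ∀ t ∈ Set.Icc 0 a, |u' t| ≤ 2 * u t ^ (3 / 2 : ℝ)) {e : ℝ} (he : 0 < e) :
    |(√(u a + e))⁻¹ - (√(u 0 + e))⁻¹| ≤ a := by
  have hd : ∀ t ∈ Set.Icc 0 a, HasDerivAt (fun t => (√(u t + e))⁻¹)
      (-(u' t / (2 * √(u t + e))) / (√(u t + e)) ^ 2) t := by
    intro t ht
    have hp : 0 < u t + e := by linarith [h0 t ht]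
    exact (((hu t ht).add_const e).sqrt hp.ne').inv (Real.sqrt_pos.2 hp).ne'
  have := Convex.norm_image_sub_le_of_norm_hasDerivWithin_le (C := 1)
    (fun t ht => (hd t ht).hasDerivWithinAt) (fun t ht => ?_) (convex_Icc 0 a)
    (Set.left_mem_Icc.2 ha) (Set.right_mem_Icc.2 ha)
  · simpa [Real.norm_eq_abs, abs_of_nonneg ha] using this
  · have hp : 0 < u t + e := by linarith [h0 t ht]
    have hs : 0 < √(u t + e) := Real.sqrt_pos.2 hp
    have e3 : u t ^ (3 / 2 : ℝ) ≤ √(u t + e) ^ 3 := by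
      rw [Real.sqrt_eq_rpow, ← Real.rpow_natCast, ← Real.rpow_mul hp.le]
      norm_num
      exact Real.rpow_le_rpow (h0 t ht) (by linarith) (by norm_num)
    rw [Real.norm_eq_abs, neg_div, abs_neg, div_div, abs_div,
      abs_of_pos (by positivity : 0 < 2 * √(u t + e) * √(u t + e) ^ 2),
      div_le_one (by positivity)]
    have := hb t ht
    nlinarith

/-- The bounds `r / (1 + a r) ≤ √(u a) ≤ r / (1 - a r)` with `r = √(u 0)`, free of divisions: the
limit `e → 0` of the Lipschitz estimate. -/
lemma sqrt_second_deriv_bounds {u u' : ℝ → ℝ} {a : ℝ} (ha : 0 ≤ a)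
    (hu : ∀ t ∈ Set.Icc 0 a, HasDerivAt u (u' t) t) (h0 : ∀ t ∈ Set.Icc 0 a, 0 ≤ u t)
    (hb : ∀ t ∈ Set.Icc 0 a, |u' t| ≤ 2 * u t ^ (3 / 2 : ℝ)) :
    √(u 0) ≤ √(u a) * (1 + a * √(u 0)) ∧ √(u a) * (1 - a * √(u 0)) ≤ √(u 0) := by
  have hlim : ∀ {f g : ℝ → ℝ}, Continuous f → Continuous g → (∀ e, 0 < e → f e ≤ g e) →
      f 0 ≤ g 0 := by
    intro f g hf hg h
    refine le_of_tendsto_of_tendsto (b := 𝓝[>] (0 : ℝ)) ((hf.tendsto 0).mono_left inf_le_left)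
      ((hg.tendsto 0).mono_left inf_le_left) ?_
    filter_upwards [self_mem_nhdsWithin] with e he using h e he
  have main : ∀ e, 0 < e → √(u 0 + e) ≤ √(u a + e) * (1 + a * √(u 0 + e)) ∧
      √(u a + e) * (1 - a * √(u 0 + e)) ≤ √(u 0 + e) := by
    intro e he
    have h := abs_le.1 (abs_inv_sqrt_sub_le ha hu h0 hb he)
    have p0 : 0 < √(u 0 + e) :=
      Real.sqrt_pos.2 (by linarith [h0 0 (Set.left_mem_Icc.2 ha)])
    have pa : 0 < √(u a + e) :=
      Real.sqrt_pos.2 (by linarith [h0 a (Set.right_mem_Icc.2 ha)])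
    have hm := mul_pos p0 pa
    have e1 : √(u 0 + e) * √(u a + e) * ((√(u a + e))⁻¹ - (√(u 0 + e))⁻¹) =
      √(u 0 + e) - √(u a + e) := by field_simp
    constructor <;> nlinarith
  refine ⟨?_, ?_⟩
  · have := hlim (f := fun e => √(u 0 + e)) (g := fun e => √(u a + e) * (1 + a * √(u 0 + e)))
      (by fun_prop) (by fun_prop) (fun e he => (main e he).1)
    simpa using this
  · have := hlim (g := fun e => √(u 0 + e)) (f := fun e => √(u a + e) * (1 - a * √(u 0 + e)))
      (by fun_prop) (by fun_prop) (fun e he => (main e he).2)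
    simpa using this

section Line

variable {φ φ1 u u' : ℝ → ℝ} {a : ℝ}

lemma hasDerivAt_mul_sub_log {r t : ℝ} (h : 0 < 1 + r * t) :
    HasDerivAt (fun t => r * t - Real.log (1 + r * t)) (r - r / (1 + r * t)) t := by
  have h1 : HasDerivAt (fun t => r * t) r t := by simpa using (hasDerivAt_id t).const_mul r
  exact h1.sub ((h1.const_add 1).log h.ne')

lemma hasDerivAt_sub_div {r t : ℝ} (h : 0 < 1 + r * t) :
    HasDerivAt (fun t => r - r / (1 + r * t)) (r ^ 2 / (1 + r * t) ^ 2) t := by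
  have h1 : HasDerivAt (fun t => r * t) r t := by simpa using (hasDerivAt_id t).const_mul r
  refine (((hasDerivAt_const t r).div (h1.const_add 1) h.ne').const_sub r).congr_deriv ?_
  ring

/-- The lower self-concordance bound on a line, for `u = φ''`; it holds for steps of any length. -/
lemma le_of_self_concordant_line (ha : 0 ≤ a)
    (h1 : ∀ t ∈ Set.Icc 0 a, HasDerivAt φ (φ1 t) t)
    (h2 : ∀ t ∈ Set.Icc 0 a, HasDerivAt φ1 (u t) t)
    (hu : ∀ t ∈ Set.Icc 0 a, HasDerivAt u (u' t) t) (h0 : ∀ t ∈ Set.Icc 0 a, 0 ≤ u t)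
    (hb : ∀ t ∈ Set.Icc 0 a, |u' t| ≤ 2 * u t ^ (3 / 2 : ℝ)) :
    φ 0 + φ1 0 * a + omegaLow (√(u 0) * a) ≤ φ a := by
  set r := √(u 0) with hr
  have hr0 : 0 ≤ r := Real.sqrt_nonneg _
  have hp : ∀ t ∈ Set.Icc 0 a, 0 < 1 + r * t := fun t ht => by
    have := mul_nonneg hr0 ht.1; linarith
  have := nonneg_of_second_deriv_nonneg (a := a)
    (D := fun t => φ t - φ 0 - φ1 0 * t - (r * t - Real.log (1 + r * t)))
    (D1 := fun t => φ1 t - φ1 0 - (r - r / (1 + r * t)))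
    (D2 := fun t => u t - r ^ 2 / (1 + r * t) ^ 2) ha ?_ ?_ ?_ (by simp) (by simp)
  · simp only [omegaLow]; linarith
  · intro t ht
    have h3 : HasDerivAt (fun t => φ1 0 * t) (φ1 0) t := by
      simpa using (hasDerivAt_id t).const_mul (φ1 0)
    exact (((h1 t ht).sub_const _).sub h3).sub (hasDerivAt_mul_sub_log (hp t ht))
  · intro t ht
    exact ((h2 t ht).sub_const _).sub (hasDerivAt_sub_div (hp t ht))
  · intro t ht
    have hsub : ∀ s ∈ Set.Icc 0 t, s ∈ Set.Icc 0 a := fun s hs => ⟨hs.1, hs.2.trans ht.2⟩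
    have hk := (sqrt_second_deriv_bounds ht.1 (fun s hs => hu s (hsub s hs))
      (fun s hs => h0 s (hsub s hs)) (fun s hs => hb s (hsub s hs))).1
    rw [← hr] at hk
    have hpt := hp t ht
    rw [sub_nonneg, ← div_pow, ← Real.sq_sqrt (h0 t ht)]
    refine pow_le_pow_left₀ (by positivity) ?_ 2
    rw [div_le_iff₀ hpt]
    linarith [mul_comm t r]

/-- The upper self-concordance bound on a line, for `u = φ''` and steps of local length below
`1`. -/
lemma self_concordant_line_le (ha : 0 ≤ a)
    (h1 : ∀ t ∈ Set.Icc 0 a, HasDerivAt φ (φ1 t) t)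
    (h2 : ∀ t ∈ Set.Icc 0 a, HasDerivAt φ1 (u t) t)
    (hu : ∀ t ∈ Set.Icc 0 a, HasDerivAt u (u' t) t) (h0 : ∀ t ∈ Set.Icc 0 a, 0 ≤ u t)
    (hb : ∀ t ∈ Set.Icc 0 a, |u' t| ≤ 2 * u t ^ (3 / 2 : ℝ)) (hra : √(u 0) * a < 1) :
    φ a ≤ φ 0 + φ1 0 * a + omegaStar (√(u 0) * a) := by
  set r := √(u 0) with hr
  have hr0 : 0 ≤ r := Real.sqrt_nonneg _
  have hp : ∀ t ∈ Set.Icc 0 a, 0 < 1 + (-r) * t := fun t ht => by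
    have := mul_le_mul_of_nonneg_left ht.2 hr0; linarith
  have := nonneg_of_second_deriv_nonneg (a := a)
    (D := fun t => φ 0 + φ1 0 * t + ((-r) * t - Real.log (1 + (-r) * t)) - φ t)
    (D1 := fun t => φ1 0 + ((-r) - (-r) / (1 + (-r) * t)) - φ1 t)
    (D2 := fun t => (-r) ^ 2 / (1 + (-r) * t) ^ 2 - u t) ha ?_ ?_ ?_ (by simp) (by simp)
  · simp only [omegaStar]
    have e : 1 + -r * a = 1 - r * a := by ring
    rw [e] at this
    linarith
  · intro t ht
    have h3 : HasDerivAt (fun t => φ1 0 * t) (φ1 0) t := by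
      simpa using (hasDerivAt_id t).const_mul (φ1 0)
    exact ((h3.const_add _).add (hasDerivAt_mul_sub_log (hp t ht))).sub (h1 t ht)
  · intro t ht
    exact ((hasDerivAt_sub_div (hp t ht)).const_add _).sub (h2 t ht)
  · intro t ht
    have hsub : ∀ s ∈ Set.Icc 0 t, s ∈ Set.Icc 0 a := fun s hs => ⟨hs.1, hs.2.trans ht.2⟩
    have hk := (sqrt_second_deriv_bounds ht.1 (fun s hs => hu s (hsub s hs))
      (fun s hs => h0 s (hsub s hs)) (fun s hs => hb s (hsub s hs))).2
    rw [← hr] at hk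
    have hpt := hp t ht
    rw [sub_nonneg, neg_sq, ← div_pow, ← Real.sq_sqrt (h0 t ht)]
    refine pow_le_pow_left₀ (Real.sqrt_nonneg _) ?_ 2
    rw [le_div_iff₀ hpt]
    have : 1 + -r * t = 1 - t * r := by ring
    rw [this]
    exact hk

end Line

/-! ### Positive definite operators into the dual space -/

/-- `B : V → V^*` is symmetric and positive definite. -/
structure IsPosDefForm {V : Type*} [NormedAddCommGroup V] [NormedSpace ℝ V]
    (B : V →L[ℝ] StrongDual ℝ V) : Prop where
  symm : ∀ h k : V, B h k = B k h
  pos : ∀ h : V, h ≠ 0 → 0 < B h h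

/-- The primal local norm `⟨B h, h⟩^{1/2}`; `dualLocalNorm B` is the conjugate norm. -/
noncomputable def localNorm {V : Type*} [NormedAddCommGroup V] [NormedSpace ℝ V]
    (B : V →L[ℝ] StrongDual ℝ V) (h : V) : ℝ := √(B h h)

/-- The evaluation map `V → V^{**}`. -/
noncomputable def evalDual (V : Type*) [NormedAddCommGroup V] [NormedSpace ℝ V] :
    V →L[ℝ] StrongDual ℝ (StrongDual ℝ V) :=
  (ContinuousLinearMap.id ℝ (StrongDual ℝ V)).flip

@[simp] lemma evalDual_apply {V : Type*} [NormedAddCommGroup V] [NormedSpace ℝ V] (x : V)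
    (g : StrongDual ℝ V) : evalDual V x g = g x := rfl

/-- The inverse of `B : V → V^*`, regarded as an operator from `V^*` to its dual space; its local
norm is `dualLocalNorm B`. -/
noncomputable def dualForm {V : Type*} [NormedAddCommGroup V] [NormedSpace ℝ V]
    (B : V →L[ℝ] StrongDual ℝ V) : StrongDual ℝ V →L[ℝ] StrongDual ℝ (StrongDual ℝ V) :=
  (evalDual V).comp B.inverse

section Forms

variable {V W : Type*} [NormedAddCommGroup V] [NormedSpace ℝ V] [NormedAddCommGroup W]
  [NormedSpace ℝ W] {B : V →L[ℝ] StrongDual ℝ V}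

@[simp] lemma dualForm_apply (B : V →L[ℝ] StrongDual ℝ V) (g k : StrongDual ℝ V) :
    dualForm B g k = k (B.inverse g) := rfl

lemma localNorm_dualForm (B : V →L[ℝ] StrongDual ℝ V) (g : StrongDual ℝ V) :
    localNorm (dualForm B) g = dualLocalNorm B g := rfl

lemma localNorm_nonneg (B : V →L[ℝ] StrongDual ℝ V) (h : V) : 0 ≤ localNorm B h :=
  Real.sqrt_nonneg _

lemma localNorm_smul (B : V →L[ℝ] StrongDual ℝ V) (a : ℝ) (h : V) :
    localNorm B (a • h) = |a| * localNorm B h := by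
  unfold localNorm
  rw [map_smul, map_smul, smul_eq_mul, smul_apply, smul_eq_mul, ← mul_assoc,
    Real.sqrt_mul (mul_self_nonneg a), Real.sqrt_mul_self_eq_abs]

lemma localNorm_neg (B : V →L[ℝ] StrongDual ℝ V) (h : V) : localNorm B (-h) = localNorm B h := by
  simp [localNorm]

lemma localNorm_bilinearComp (B : V →L[ℝ] StrongDual ℝ V) (L : W →L[ℝ] V) (h : W) :
    localNorm (B.bilinearComp L L) h = localNorm B (L h) := rfl

namespace IsPosDefForm

lemma nonneg (hB : IsPosDefForm B) (h : V) : 0 ≤ B h h := by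
  by_cases h0 : h = 0
  · simp [h0]
  · exact (hB.pos h h0).le

lemma localNorm_sq (hB : IsPosDefForm B) (h : V) : localNorm B h ^ 2 = B h h :=
  Real.sq_sqrt (hB.nonneg h)

lemma localNorm_pos (hB : IsPosDefForm B) {h : V} (h0 : h ≠ 0) : 0 < localNorm B h :=
  Real.sqrt_pos.2 (hB.pos h h0)

lemma abs_apply_le (hB : IsPosDefForm B) (h k : V) :
    |B h k| ≤ localNorm B h * localNorm B k := by
  have h1 : B h k ^ 2 ≤ B h h * B k k := by
    have h2 := hB.nonneg (B k k • h - B h k • k)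
    simp only [map_sub, map_smul, sub_apply, smul_apply,
      smul_eq_mul, hB.symm k h] at h2
    by_cases hk : k = 0
    · simp [hk]
    · have := hB.pos k hk
      have h3 : 0 ≤ B k k * (B h h * B k k - B h k ^ 2) := by linarith
      nlinarith [nonneg_of_mul_nonneg_right h3 this]
  rw [← Real.sqrt_sq_eq_abs, localNorm, localNorm, ← Real.sqrt_mul (hB.nonneg h)]
  exact Real.sqrt_le_sqrt h1

lemma localNorm_add_le (hB : IsPosDefForm B) (h k : V) :
    localNorm B (h + k) ≤ localNorm B h + localNorm B k := by
  refine abs_le_of_sq_le_sq' ?_ (add_nonneg (localNorm_nonneg B h) (localNorm_nonneg B k)) |>.2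
  have h1 := le_of_abs_le (hB.abs_apply_le h k)
  rw [add_sq, hB.localNorm_sq, hB.localNorm_sq, hB.localNorm_sq]
  simp only [map_add, add_apply, hB.symm k h]
  linarith

lemma bilinearComp (hB : IsPosDefForm B) {L : W →L[ℝ] V} (hL : Function.Injective L) :
    IsPosDefForm (B.bilinearComp L L) where
  symm h k := by simpa using hB.symm _ _
  pos h h0 := by
    have : L h ≠ 0 := fun e => h0 (hL (by simpa using e))
    simpa using hB.pos _ this

variable [FiniteDimensional ℝ V]

lemma exists_equiv (hB : IsPosDefForm B) :
    ∃ e : V ≃L[ℝ] StrongDual ℝ V, (e : V →L[ℝ] StrongDual ℝ V) = B := by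
  have hinj : Function.Injective (B : V →ₗ[ℝ] StrongDual ℝ V) := by
    rw [← LinearMap.ker_eq_bot, LinearMap.ker_eq_bot']
    intro h h0
    by_contra hne
    have := hB.pos h hne
    have h0' : B h = 0 := h0
    rw [h0'] at this
    simp at this
  have hfin : Module.finrank ℝ V = Module.finrank ℝ (StrongDual ℝ V) := by
    rw [← Subspace.dual_finrank_eq]
    exact (LinearMap.toContinuousLinearMap (𝕜 := ℝ) (E := V) (F' := ℝ)).finrank_eq
  refine ⟨(LinearMap.linearEquivOfInjective _ hinj hfin).toContinuousLinearEquiv, ?_⟩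
  ext h k
  rfl

lemma apply_inverse (hB : IsPosDefForm B) (g : StrongDual ℝ V) : B (B.inverse g) = g := by
  obtain ⟨e, rfl⟩ := hB.exists_equiv
  simp

lemma inverse_apply (hB : IsPosDefForm B) (h : V) : B.inverse (B h) = h := by
  obtain ⟨e, rfl⟩ := hB.exists_equiv
  simp

lemma dualForm (hB : IsPosDefForm B) : IsPosDefForm (dualForm B) where
  symm g k := by
    have := hB.symm (B.inverse g) (B.inverse k)
    rw [hB.apply_inverse, hB.apply_inverse] at this
    simpa using this.symm
  pos g h0 := by
    have h1 : B.inverse g ≠ 0 := fun e => h0 (by rw [← hB.apply_inverse g, e, map_zero])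
    have := hB.pos _ h1
    rwa [hB.apply_inverse] at this

lemma localNorm_inverse (hB : IsPosDefForm B) (g : StrongDual ℝ V) :
    localNorm B (B.inverse g) = dualLocalNorm B g := by
  rw [localNorm, hB.apply_inverse, dualLocalNorm]

lemma abs_apply_le_dual (hB : IsPosDefForm B) (g : StrongDual ℝ V) (h : V) :
    |g h| ≤ dualLocalNorm B g * localNorm B h := by
  have := hB.abs_apply_le (B.inverse g) h
  rwa [hB.apply_inverse, hB.localNorm_inverse] at this

/-- The local norm dominates the ambient norm. -/
lemma exists_norm_le (hB : IsPosDefForm B) : ∃ C : ℝ, 0 < C ∧ ∀ h, ‖h‖ ≤ C * localNorm B h := by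
  refine ⟨‖B.inverse‖ * √‖B‖ + 1, by positivity, fun h => ?_⟩
  have h1 : ‖B h‖ ≤ √‖B‖ * localNorm B h := by
    refine ContinuousLinearMap.opNorm_le_bound _ (mul_nonneg (by positivity)
      (localNorm_nonneg B h)) fun k => ?_
    have h2 : localNorm B k ≤ √‖B‖ * ‖k‖ := by
      refine Real.sqrt_le_iff.2 ⟨by positivity, ?_⟩
      rw [mul_pow, Real.sq_sqrt (norm_nonneg B)]
      have := B.le_opNorm₂ k k
      rw [Real.norm_eq_abs] at this
      linarith [le_abs_self (B k k)]
    have := hB.abs_apply_le h k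
    rw [Real.norm_eq_abs]
    nlinarith [mul_le_mul_of_nonneg_left h2 (localNorm_nonneg B h)]
  have h3 : ‖h‖ ≤ ‖B.inverse‖ * ‖B h‖ := by
    conv_lhs => rw [← hB.inverse_apply h]
    exact B.inverse.le_opNorm _
  nlinarith [mul_le_mul_of_nonneg_left h1 (norm_nonneg B.inverse), localNorm_nonneg B h]

end IsPosDefForm

end Forms

lemma hasFDerivAt_clm_comp {X Y Z : Type*} [NormedAddCommGroup X] [NormedSpace ℝ X]
    [NormedAddCommGroup Y] [NormedSpace ℝ Y] [NormedAddCommGroup Z] [NormedSpace ℝ Z]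
    (L : Y →L[ℝ] Z) {f : X → Y} {f' : X →L[ℝ] Y} {x : X} (h : HasFDerivAt f f' x) :
    HasFDerivAt (fun z => L (f z)) (L.comp f') x :=
  L.hasFDerivAt.comp x h

/-! ### Two-sided self-concordance bounds -/

/-- The consequences of self-concordance that are stable under conjugation and under restriction
to affine subspaces: at every point of the open domain `U`, the function `f` with gradient `g` and
positive definite Hessian `H` has the unit Dikin ellipsoid in its domain, is at most
`f x + ⟨g x, h⟩ + ω_*(‖h‖_x)` in it, and at least `f x + ⟨g x, h⟩ + ω(‖h‖_x)` everywhere. -/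
structure SelfConcordantModel {V : Type*} [NormedAddCommGroup V] [NormedSpace ℝ V] (U : Set V)
    (f : V → ℝ) (g : V → StrongDual ℝ V) (H : V → V →L[ℝ] StrongDual ℝ V) : Prop where
  posDef : ∀ x ∈ U, IsPosDefForm (H x)
  dikin : ∀ x ∈ U, ∀ h, localNorm (H x) h < 1 → x + h ∈ U
  upper : ∀ x ∈ U, ∀ h, localNorm (H x) h < 1 →
    f (x + h) ≤ f x + g x h + omegaStar (localNorm (H x) h)
  lower : ∀ x ∈ U, ∀ h, x + h ∈ U → f x + g x h + omegaLow (localNorm (H x) h) ≤ f (x + h)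

namespace SelfConcordantModel

variable {V W : Type*} [NormedAddCommGroup V] [NormedSpace ℝ V] [NormedAddCommGroup W]
  [NormedSpace ℝ W] {U : Set V} {f : V → ℝ} {g : V → StrongDual ℝ V}
  {H : V → V →L[ℝ] StrongDual ℝ V}

lemma add_linear (hM : SelfConcordantModel U f g H) (l : StrongDual ℝ V) :
    SelfConcordantModel U (fun x => f x + l x) (fun x => g x + l) H where
  posDef := hM.posDef
  dikin := hM.dikin
  upper x hx h hh := by
    have := hM.upper x hx h hh
    simp only [map_add, add_apply]
    linarith
  lower x hx h hh := by
    have := hM.lower x hx h hh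
    simp only [map_add, add_apply]
    linarith

lemma comp_affine (hM : SelfConcordantModel U f g H) {L : W →L[ℝ] V} (hL : Function.Injective L)
    (v : V) :
    SelfConcordantModel {w | v + L w ∈ U} (fun w => f (v + L w)) (fun w => (g (v + L w)).comp L)
      (fun w => (H (v + L w)).bilinearComp L L) where
  posDef w hw := (hM.posDef _ hw).bilinearComp hL
  dikin w hw h hh := by
    simpa [add_assoc] using hM.dikin (v + L w) hw (L h) hh
  upper w hw h hh := by
    simpa [add_assoc, localNorm_bilinearComp] using hM.upper (v + L w) hw (L h) hh
  lower w hw h hh := by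
    simpa [add_assoc, localNorm_bilinearComp] using
      hM.lower (v + L w) hw (L h) (by simpa [add_assoc] using hh)

lemma congr (hM : SelfConcordantModel U f g H) {g' : V → StrongDual ℝ V}
    {H' : V → V →L[ℝ] StrongDual ℝ V} (hg : ∀ x ∈ U, g' x = g x) (hH : ∀ x ∈ U, H' x = H x) :
    SelfConcordantModel U f g' H' where
  posDef x hx := by rw [hH x hx]; exact hM.posDef x hx
  dikin x hx h hh := by rw [hH x hx] at hh; exact hM.dikin x hx h hh
  upper x hx h hh := by rw [hH x hx] at hh ⊢; rw [hg x hx]; exact hM.upper x hx h hh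
  lower x hx h hh := by rw [hH x hx, hg x hx]; exact hM.lower x hx h hh

lemma le_of_grad_eq_zero (hM : SelfConcordantModel U f g H) {x y : V} (hx : x ∈ U) (hy : y ∈ U)
    (h0 : g x = 0) : f x ≤ f y := by
  have := hM.lower x hx (y - x) (by simpa using hy)
  rw [h0] at this
  simp only [add_sub_cancel, zero_apply] at this
  linarith [omegaLow_nonneg (localNorm_nonneg (H x) (y - x))]

/-- The gradient is injective, by strict convexity. -/
lemma eq_of_grad_eq (hM : SelfConcordantModel U f g H) {x y : V} (hx : x ∈ U) (hy : y ∈ U)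
    (h0 : g x = g y) : x = y := by
  by_contra hne
  have h1 := hM.lower x hx (y - x) (by simpa using hy)
  have h2 := hM.lower y hy (x - y) (by simpa using hx)
  have h3 := omegaLow_pos ((hM.posDef x hx).localNorm_pos (sub_ne_zero.2 (Ne.symm hne)))
  have h4 := omegaLow_nonneg (localNorm_nonneg (H y) (x - y))
  rw [h0] at h1
  simp only [add_sub_cancel, map_sub] at h1 h2
  linarith

lemma hasFDerivAt (hM : SelfConcordantModel U f g H) {x : V} (hx : x ∈ U) :
    HasFDerivAt f (g x) x := by
  rw [hasFDerivAt_iff_isLittleO_nhds_zero]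
  have hlt : ∀ᶠ h : V in 𝓝 0, localNorm (H x) h < 1 / 2 := by
    have hc : Continuous fun h => localNorm (H x) h := by unfold localNorm; fun_prop
    exact hc.continuousAt.eventually_lt continuousAt_const (by simp [localNorm])
  have hO : (fun h => f (x + h) - f x - g x h) =O[𝓝 0] fun h : V => ‖h‖ ^ 2 := by
    refine Asymptotics.IsBigO.of_bound ‖H x‖ ?_
    filter_upwards [hlt] with h hh
    have h1 := hM.upper x hx h (by linarith)
    have h2 := hM.lower x hx h (hM.dikin x hx h (by linarith))
    have h3 := omegaStar_le (localNorm_nonneg (H x) h) (by linarith)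
    have h4 := omegaLow_nonneg (localNorm_nonneg (H x) h)
    have h5 : localNorm (H x) h ^ 2 / (2 * (1 - localNorm (H x) h)) ≤ localNorm (H x) h ^ 2 :=
      div_le_self (by positivity) (by linarith)
    have h6 : localNorm (H x) h ^ 2 ≤ ‖H x‖ * ‖h‖ ^ 2 := by
      rw [(hM.posDef x hx).localNorm_sq]
      have := (H x).le_opNorm₂ h h
      rw [Real.norm_eq_abs] at this
      nlinarith [le_abs_self (H x h h)]
    rw [Real.norm_eq_abs, abs_of_nonneg (by linarith), norm_pow, norm_norm]
    linarith
  exact hO.trans_isLittleO ((Asymptotics.isLittleO_norm_pow_id one_lt_two))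

variable [FiniteDimensional ℝ V]

/-- The damped Newton step stays in the domain and decreases the function by `ω(λ)`. -/
lemma damped_step (hM : SelfConcordantModel U f g H) {x : V} (hx : x ∈ U) :
    x - (1 / (1 + dualLocalNorm (H x) (g x))) • (H x).inverse (g x) ∈ U ∧
    f (x - (1 / (1 + dualLocalNorm (H x) (g x))) • (H x).inverse (g x)) ≤
      f x - omegaLow (dualLocalNorm (H x) (g x)) := by
  have hB := hM.posDef x hx
  set l := dualLocalNorm (H x) (g x) with hl
  set d := (H x).inverse (g x) with hd
  have hl0 : 0 ≤ l := Real.sqrt_nonneg _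
  have hp : 0 < 1 + l := by linarith
  have hn : localNorm (H x) (-((1 / (1 + l)) • d)) = l / (1 + l) := by
    rw [localNorm_neg, localNorm_smul, hd, hB.localNorm_inverse, ← hl, abs_of_pos (by positivity)]
    ring
  have hlt : localNorm (H x) (-((1 / (1 + l)) • d)) < 1 := by
    rw [hn, div_lt_one hp]; linarith
  have hgd : g x d = l ^ 2 := by
    rw [hl, ← hB.localNorm_inverse, hB.localNorm_sq, hB.apply_inverse]
  rw [sub_eq_add_neg]
  refine ⟨hM.dikin x hx _ hlt, (hM.upper x hx _ hlt).trans ?_⟩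
  rw [hn, omegaStar_div_one_add hl0, map_neg, map_smul, hgd, smul_eq_mul]
  have : 1 / (1 + l) * l ^ 2 = l / (1 + l) * l := by ring
  linarith

/-- A model that is bounded below has a critical point: the decrement is small at almost minimal
points, and then there is a minimizer over a small ellipsoid in its interior. -/
lemma exists_grad_eq_zero (hM : SelfConcordantModel U f g H) (hne : U.Nonempty) {m : ℝ}
    (hm : ∀ x ∈ U, m ≤ f x) : ∃ x ∈ U, g x = 0 := by
  obtain ⟨x, hx, hdec⟩ : ∃ x ∈ U, dualLocalNorm (H x) (g x) < 1 / 10 := by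
    have hbd : BddBelow (f '' U) := ⟨m, by rintro _ ⟨x, hx, rfl⟩; exact hm x hx⟩
    obtain ⟨_, ⟨x, hx, rfl⟩, hlt⟩ := Real.lt_sInf_add_pos (hne.image f)
      (omegaLow_pos (r := 1 / 10) (by norm_num))
    refine ⟨x, hx, ?_⟩
    by_contra! hc
    obtain ⟨h1, h2⟩ := hM.damped_step hx
    have h3 := csInf_le hbd (Set.mem_image_of_mem f h1)
    have h4 := omegaLow_mono (by norm_num) hc
    linarith
  have hB := hM.posDef x hx
  have hc : Continuous fun h => localNorm (H x) h := by unfold localNorm; fun_prop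
  have hcomp : IsCompact {h : V | localNorm (H x) h ≤ 1 / 2} := by
    obtain ⟨C, hC, hle⟩ := hB.exists_norm_le
    refine Metric.isCompact_of_isClosed_isBounded (isClosed_Iic.preimage hc) ?_
    refine (Metric.isBounded_closedBall (x := (0 : V)) (r := C * (1 / 2))).subset fun h hh => ?_
    rw [mem_closedBall_zero_iff]
    exact (hle h).trans (mul_le_mul_of_nonneg_left hh hC.le)
  have hin : ∀ h, localNorm (H x) h ≤ 1 / 2 → x + h ∈ U := fun h hh =>
    hM.dikin x hx h (by linarith)
  have hcont : ContinuousOn (fun h => f (x + h)) {h : V | localNorm (H x) h ≤ 1 / 2} :=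
    fun h hh => ((hM.hasFDerivAt (hin h hh)).continuousAt.comp
      (by fun_prop : ContinuousAt (fun h => x + h) h)).continuousWithinAt
  obtain ⟨h, hh, hmin⟩ := hcomp.exists_isMinOn ⟨0, by simp [localNorm]⟩ hcont
  have hh' : localNorm (H x) h ≤ 1 / 2 := hh
  refine ⟨x + h, hin h hh, ?_⟩
  have hlt : localNorm (H x) h < 1 / 2 := by
    refine lt_of_le_of_ne hh fun e => ?_
    have h1 := hM.lower x hx h (hin h hh)
    have h2 : f (x + h) ≤ f (x + 0) := hmin (by simp [localNorm])
    have h3 := abs_le.1 (hB.abs_apply_le_dual (g x) h)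
    have h4 := omegaLow_ge (r := 1 / 2) (by norm_num)
    rw [e] at h1 h3
    norm_num at h4 h2 h3
    linarith
  refine IsLocalMin.hasFDerivAt_eq_zero ?_ (hM.hasFDerivAt (hin h hh))
  have hc2 : Continuous fun y => localNorm (H x) (y - x) := hc.comp (by fun_prop)
  have : {y | localNorm (H x) (y - x) < 1 / 2} ∈ 𝓝 (x + h) :=
    (isOpen_Iio.preimage hc2).mem_nhds (by simpa using hlt)
  filter_upwards [this] with y hy
  have hy' : localNorm (H x) (y - x) < 1 / 2 := hy
  have := hmin (show y - x ∈ {h : V | localNorm (H x) h ≤ 1 / 2} from hy'.le)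
  simpa using this

/-- A point with a small decrement `λ` is at local distance at most `2 λ` from the minimizer. -/
lemma localNorm_sub_le_of_grad_eq_zero (hM : SelfConcordantModel U f g H) {x z : V} (hx : x ∈ U)
    (hz : z ∈ U) (h0 : g z = 0) {l : ℝ} (hl : 0 < l) (hl' : l ≤ 1 / 8)
    (hdec : dualLocalNorm (H x) (g x) ≤ l) : localNorm (H x) (z - x) ≤ 2 * l := by
  have hr := localNorm_nonneg (H x) (z - x)
  have hd0 : 0 ≤ dualLocalNorm (H x) (g x) := Real.sqrt_nonneg _
  rcases hd0.eq_or_lt with h | h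
  · -- a vanishing decrement means that `x` is the minimizer itself
    have hgx : g x = 0 := by
      by_contra hne
      exact absurd h.symm ((hM.posDef x hx).dualForm.localNorm_pos hne).ne'
    have : z = x := hM.eq_of_grad_eq hz hx (by rw [h0, hgx])
    simp [this, localNorm, hl.le]
  · obtain ⟨h1, h2⟩ := hM.damped_step hx
    have h3 := hM.le_of_grad_eq_zero hz h1 h0
    have h4 := hM.lower x hx (z - x) (by simpa using hz)
    have h5 := abs_le.1 ((hM.posDef x hx).abs_apply_le_dual (g x) (z - x))
    rw [add_sub_cancel] at h4
    have := le_two_mul_of_omegaLow_le h (hdec.trans hl') (by linarith) hr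
    linarith

end SelfConcordantModel

/-! ### Barriers with the two-sided bounds -/

section Barrier

variable {V : Type*} [NormedAddCommGroup V] [NormedSpace ℝ V] {U : Set V} {f : V → ℝ} {ν : ℝ}

lemma IsSelfConcordant.contDiffAt (hf : IsSelfConcordant U f) {x : V} (hx : x ∈ U) :
    ContDiffAt ℝ 3 f x :=
  hf.smooth.contDiffAt (hf.isOpen.mem_nhds hx)

lemma IsSelfConcordant.hasFDerivAt (hf : IsSelfConcordant U f) {x : V} (hx : x ∈ U) :
    HasFDerivAt f (fderiv ℝ f x) x :=
  ((hf.contDiffAt hx).differentiableAt (by norm_num)).hasFDerivAt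

lemma IsSelfConcordant.contDiffAt_fderiv (hf : IsSelfConcordant U f) {x : V} (hx : x ∈ U) :
    ContDiffAt ℝ 2 (fderiv ℝ f) x :=
  (hf.contDiffAt hx).fderiv_right (by norm_num)

lemma IsSelfConcordant.hasStrictFDerivAt_fderiv (hf : IsSelfConcordant U f) {x : V} (hx : x ∈ U) :
    HasStrictFDerivAt (fderiv ℝ f) (hess f x) x :=
  (hf.contDiffAt_fderiv hx).hasStrictFDerivAt (by norm_num)

lemma hasDerivAt_add_smul (x h : V) (t : ℝ) : HasDerivAt (fun t : ℝ => x + t • h) h t := by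
  simpa using ((hasDerivAt_id t).smul_const h).const_add x

lemma IsSelfConcordant.hasDerivAt_line (hf : IsSelfConcordant U f) {x h : V} {t : ℝ}
    (hx : x + t • h ∈ U) :
    HasDerivAt (fun t : ℝ => f (x + t • h)) (fderiv ℝ f (x + t • h) h) t :=
  (hf.hasFDerivAt hx).comp_hasDerivAt t (hasDerivAt_add_smul x h t)

lemma IsSelfConcordant.hasDerivAt_fderiv_line (hf : IsSelfConcordant U f) {x h : V} {t : ℝ}
    (hx : x + t • h ∈ U) :
    HasDerivAt (fun t : ℝ => fderiv ℝ f (x + t • h) h) (hess f (x + t • h) h h) t := by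
  have h1 : HasDerivAt (fun t : ℝ => fderiv ℝ f (x + t • h)) (hess f (x + t • h) h) t :=
    (hf.hasStrictFDerivAt_fderiv hx).hasFDerivAt.comp_hasDerivAt t (hasDerivAt_add_smul x h t)
  have h2 := (ContinuousLinearMap.apply ℝ ℝ h).hasFDerivAt.comp_hasDerivAt t h1
  exact h2

lemma IsSelfConcordant.hasDerivAt_hess_line (hf : IsSelfConcordant U f) {x h : V} {t : ℝ}
    (hx : x + t • h ∈ U) :
    HasDerivAt (fun t : ℝ => hess f (x + t • h) h h)
      (iteratedFDeriv ℝ 3 f (x + t • h) fun _ => h) t := by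
  have h1 : HasFDerivAt (iteratedFDeriv ℝ 2 f) (fderiv ℝ (iteratedFDeriv ℝ 2 f) (x + t • h))
      (x + t • h) :=
    ((hf.contDiffAt hx).differentiableAt_iteratedFDeriv (by norm_num)).hasFDerivAt
  have h2 := h1.comp_hasDerivAt t (hasDerivAt_add_smul x h t)
  have h3 := (ContinuousMultilinearMap.apply ℝ (fun _ : Fin 2 => V) ℝ
    (fun _ => h)).hasFDerivAt.comp_hasDerivAt t h2
  refine (h3.congr_deriv ?_).congr_of_eventuallyEq ?_
  · rw [iteratedFDeriv_succ_apply_left]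
    rfl
  · filter_upwards with s
    simp [iteratedFDeriv_two_apply, hess]

lemma IsSelfConcordant.abs_third_le (hf : IsSelfConcordant U f) {x : V} (hx : x ∈ U) (h : V) :
    |iteratedFDeriv ℝ 3 f x fun _ => h| ≤ 2 * hess f x h h ^ (3 / 2 : ℝ) := by
  have h1 := hf.third_le x hx h
  have h2 := hf.third_le x hx (-h)
  have h3 : (iteratedFDeriv ℝ 3 f x fun _ => -h) = -iteratedFDeriv ℝ 3 f x fun _ => h := by
    have := (iteratedFDeriv ℝ 3 f x).map_smul_univ (fun _ => (-1 : ℝ)) (fun _ => h)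
    simpa [pow_succ] using this
  rw [h3] at h2
  simp only [map_neg, neg_apply, neg_neg] at h2
  exact abs_le.2 ⟨by linarith, h1⟩

namespace IsSelfConcordantBarrier

lemma hess_nonneg (hf : IsSelfConcordantBarrier U f ν) {x : V} (hx : x ∈ U) (h : V) :
    0 ≤ hess f x h h :=
  nonneg_of_mul_nonneg_right ((sq_nonneg _).trans (hf.barrier x hx h))
    (zero_lt_one.trans_le hf.one_le)

lemma lower (hf : IsSelfConcordantBarrier U f ν) {x h : V} (hx : x ∈ U) (hh : x + h ∈ U) :
    f x + fderiv ℝ f x h + omegaLow (localNorm (hess f x) h) ≤ f (x + h) := by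
  have hin : ∀ t ∈ Set.Icc (0 : ℝ) 1, x + t • h ∈ U := fun t ht =>
    hf.convex.1.add_smul_mem hx hh ht
  have := le_of_self_concordant_line zero_le_one
    (fun t ht => hf.hasDerivAt_line (hin t ht)) (fun t ht => hf.hasDerivAt_fderiv_line (hin t ht))
    (fun t ht => hf.hasDerivAt_hess_line (hin t ht)) (fun t ht => hf.hess_nonneg (hin t ht) h)
    (fun t ht => hf.abs_third_le (hin t ht) h)
  simpa [localNorm] using this

lemma upper_of_segment (hf : IsSelfConcordantBarrier U f ν) {x h : V} {a : ℝ} (ha : 0 ≤ a)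
    (hin : ∀ t ∈ Set.Icc (0 : ℝ) a, x + t • h ∈ U) (hr : localNorm (hess f x) h * a < 1) :
    f (x + a • h) ≤ f x + fderiv ℝ f x h * a + omegaStar (localNorm (hess f x) h * a) := by
  have := self_concordant_line_le ha
    (fun t ht => hf.hasDerivAt_line (hin t ht)) (fun t ht => hf.hasDerivAt_fderiv_line (hin t ht))
    (fun t ht => hf.hasDerivAt_hess_line (hin t ht)) (fun t ht => hf.hess_nonneg (hin t ht) h)
    (fun t ht => hf.abs_third_le (hin t ht) h) (by simpa [localNorm] using hr)
  simpa [localNorm] using this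

/-- The open unit Dikin ellipsoid lies in the domain: up to the first exit from the domain along
a ray the function would stay bounded, although it blows up at the boundary. -/
lemma dikin (hf : IsSelfConcordantBarrier U f ν) {x h : V} (hx : x ∈ U)
    (hr : localNorm (hess f x) h < 1) : x + h ∈ U := by
  by_contra hout
  have hcont : Continuous fun t : ℝ => x + t • h := by fun_prop
  set S : Set ℝ := Set.Icc 0 1 ∩ {t | x + t • h ∉ U} with hS
  have hclosed : IsClosed {t : ℝ | x + t • h ∉ U} := hf.isOpen.isClosed_compl.preimage hcont
  have hcomp : IsCompact S := isCompact_Icc.inter_right hclosed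
  obtain ⟨T, hT, hTmin⟩ := hcomp.exists_isLeast ⟨1, by simp, by simpa using hout⟩
  have hTU : x + T • h ∉ U := hT.2
  have hT0 : 0 < T := by
    refine lt_of_le_of_ne hT.1.1 fun e => hTU ?_
    rw [← e]; simpa using hx
  have hin : ∀ t ∈ Set.Ico 0 T, x + t • h ∈ U := by
    intro t ht
    by_contra hc
    exact absurd (hTmin ⟨⟨ht.1, ht.2.le.trans hT.1.2⟩, hc⟩) (not_le.2 ht.2)
  have hev : ∀ᶠ t in 𝓝[<] T, t ∈ Set.Ico 0 T := Ico_mem_nhdsLT hT0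
  have htend : Tendsto (fun t : ℝ => x + t • h) (𝓝[<] T) (𝓝[U] (x + T • h)) :=
    tendsto_nhdsWithin_iff.2 ⟨(hcont.tendsto T).mono_left inf_le_left, hev.mono hin⟩
  have hfront : x + T • h ∈ frontier U := by
    rw [hf.isOpen.frontier_eq]
    exact ⟨mem_closure_iff_nhdsWithin_neBot.2 (htend.neBot), hTU⟩
  have hlim := (hf.closed _ hfront).comp htend
  set r := localNorm (hess f x) h
  have hr0 : 0 ≤ r := localNorm_nonneg _ _
  obtain ⟨t, ht, hbig⟩ := (hev.and (hlim.eventually_gt_atTop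
    (f x + |fderiv ℝ f x h| + omegaStar r))).exists
  have ht1 : t ≤ 1 := ht.2.le.trans hT.1.2
  have hrt : r * t ≤ r := mul_le_of_le_one_right hr0 ht1
  have h1 := hf.upper_of_segment ht.1 (fun s hs => hin s ⟨hs.1, hs.2.trans_lt ht.2⟩)
    (hrt.trans_lt hr)
  have h2 := omegaStar_mono (mul_nonneg hr0 ht.1) hrt hr
  have h3 : fderiv ℝ f x h * t ≤ |fderiv ℝ f x h| := by
    refine (le_abs_self _).trans ?_
    rw [abs_mul, abs_of_nonneg ht.1]
    exact mul_le_of_le_one_right (abs_nonneg _) ht1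
  simp only [Function.comp_apply] at hbig
  change f (x + t • h) ≤ _ + omegaStar (r * t) at h1
  linarith

lemma upper (hf : IsSelfConcordantBarrier U f ν) {x h : V} (hx : x ∈ U)
    (hr : localNorm (hess f x) h < 1) :
    f (x + h) ≤ f x + fderiv ℝ f x h + omegaStar (localNorm (hess f x) h) := by
  have := hf.upper_of_segment (x := x) (h := h) zero_le_one
    (fun t ht => hf.convex.1.add_smul_mem hx (hf.dikin hx hr) ht) (by simpa using hr)
  simpa using this

lemma hess_symm (hf : IsSelfConcordantBarrier U f ν) {x : V} (hx : x ∈ U) (h k : V) :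
    hess f x h k = hess f x k h :=
  (hf.contDiffAt hx).isSymmSndFDerivAt (by simp; norm_num) h k

end IsSelfConcordantBarrier

namespace IsRegularBarrier

variable {K : ProperCone ℝ V} {F : V → ℝ}

/-- In a cone without lines the Hessian is nondegenerate: along a degenerate direction the Dikin
ellipsoid would contain a whole line. -/
lemma posDef (hF : IsRegularBarrier K F ν) (hline : ∀ x : V, x ∈ K → -x ∈ K → x = 0) {x : V}
    (hx : x ∈ interior (K : Set V)) : IsPosDefForm (hess F x) where
  symm := hF.hess_symm hx
  pos h h0 := by
    by_contra hc
    have hz : hess F x h h = 0 := le_antisymm (not_lt.1 hc) (hF.hess_nonneg hx h)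
    have hall : ∀ a : ℝ, x + a • h ∈ K := fun a =>
      interior_subset (hF.dikin hx (by simp [localNorm, hz]))
    have key : ∀ e : ℝ, e * e = 1 → e • h ∈ K := by
      intro e he
      have hlim : Tendsto (fun n : ℕ => (1 / ((n : ℝ) + 1)) • x + e • h) atTop (𝓝 (e • h)) := by
        simpa using ((tendsto_one_div_add_atTop_nhds_zero_nat (𝕜 := ℝ)).smul_const x).add_const
          (e • h)
      refine K.isClosed.mem_of_tendsto hlim (Eventually.of_forall fun n => ?_)
      have hp : (0 : ℝ) < n + 1 := by positivity
      have := K.smul_mem (hall ((n + 1) * e)) (by positivity : (0 : ℝ) ≤ 1 / (n + 1))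
      have e1 : 1 / ((n : ℝ) + 1) * ((n + 1) * e) = e := by field_simp
      rwa [smul_add, smul_smul, e1] at this
    exact h0 (hline h (by simpa using key 1 (by norm_num)) (by simpa using key (-1) (by norm_num)))

lemma model (hF : IsRegularBarrier K F ν) (hline : ∀ x : V, x ∈ K → -x ∈ K → x = 0) :
    SelfConcordantModel (interior (K : Set V)) F (fderiv ℝ F) (hess F) where
  posDef _ hx := hF.posDef hline hx
  dikin _ hx _ hh := hF.dikin hx hh
  upper _ hx _ hh := hF.upper hx hh
  lower _ hx _ hh := hF.lower hx hh

open scoped Pointwise in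
lemma smul_mem_interior {x : V} (hx : x ∈ interior (K : Set V)) {τ : ℝ} (hτ : 0 < τ) :
    τ • x ∈ interior (K : Set V) := by
  have h1 : τ • interior (K : Set V) = interior (τ • (K : Set V)) := (interior_smul₀ hτ.ne' _).symm
  have h2 : τ • (K : Set V) ⊆ (K : Set V) := by
    rintro _ ⟨y, hy, rfl⟩
    exact K.smul_mem hy hτ.le
  exact interior_mono h2 (h1 ▸ Set.smul_mem_smul_set hx)

lemma ne_zero (hF : IsRegularBarrier K F ν) {x : V} (hx : x ∈ interior (K : Set V)) :
    x ≠ 0 := by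
  rintro rfl
  have h1 := hF.log_homogeneous 0 hx 2 two_pos
  have h2 := Real.log_pos (one_lt_two (α := ℝ))
  have h3 := hF.one_le
  rw [smul_zero] at h1
  nlinarith

lemma fderiv_smul (hF : IsRegularBarrier K F ν) {x : V} (hx : x ∈ interior (K : Set V)) {τ : ℝ}
    (hτ : 0 < τ) : fderiv ℝ F (τ • x) = τ⁻¹ • fderiv ℝ F x := by
  have h1 : HasFDerivAt (fun z => F (τ • z)) (τ • fderiv ℝ F (τ • x)) x := by
    have h2 : HasFDerivAt (fun z : V => τ • z) (τ • ContinuousLinearMap.id ℝ V) x :=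
      (hasFDerivAt_id x).const_smul τ
    refine ((hF.hasFDerivAt (smul_mem_interior hx hτ)).comp x h2).congr_fderiv ?_
    ext; simp
  have h3 : HasFDerivAt (fun z => F z - ν * Real.log τ) (fderiv ℝ F x) x :=
    (hF.hasFDerivAt hx).sub_const _
  have h4 : HasFDerivAt (fun z => F (τ • z)) (fderiv ℝ F x) x := by
    refine h3.congr_of_eventuallyEq ?_
    filter_upwards [isOpen_interior.mem_nhds hx] with z hz
    exact hF.log_homogeneous z hz τ hτ
  rw [← h1.unique h4, smul_smul, inv_mul_cancel₀ hτ.ne', one_smul]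

lemma hess_smul (hF : IsRegularBarrier K F ν) {x : V} (hx : x ∈ interior (K : Set V)) {τ : ℝ}
    (hτ : 0 < τ) : hess F (τ • x) = (τ ^ 2)⁻¹ • hess F x := by
  have h1 : HasFDerivAt (fun z => fderiv ℝ F (τ • z)) (τ • hess F (τ • x)) x := by
    have h2 : HasFDerivAt (fun z : V => τ • z) (τ • ContinuousLinearMap.id ℝ V) x :=
      (hasFDerivAt_id x).const_smul τ
    refine ((hF.hasStrictFDerivAt_fderiv (smul_mem_interior hx hτ)).hasFDerivAt.comp x
      h2).congr_fderiv ?_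
    ext; simp
  have h3 : HasFDerivAt (fun z => τ⁻¹ • fderiv ℝ F z) (τ⁻¹ • hess F x) x :=
    (hF.hasStrictFDerivAt_fderiv hx).hasFDerivAt.const_smul τ⁻¹
  have h4 : HasFDerivAt (fun z => fderiv ℝ F (τ • z)) (τ⁻¹ • hess F x) x := by
    refine h3.congr_of_eventuallyEq ?_
    filter_upwards [isOpen_interior.mem_nhds hx] with z hz
    exact hF.fderiv_smul hz hτ
  have h5 := h1.unique h4
  rw [pow_two, mul_inv, mul_smul, ← h5, smul_smul, inv_mul_cancel₀ hτ.ne', one_smul]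

lemma fderiv_self (hF : IsRegularBarrier K F ν) {x : V} (hx : x ∈ interior (K : Set V)) :
    fderiv ℝ F x x = -ν := by
  have h1 : HasDerivAt (fun t : ℝ => F (t • x)) (fderiv ℝ F x x) 1 := by
    have h3 : HasDerivAt (fun t : ℝ => t • x) x 1 := by
      simpa using (hasDerivAt_id (1 : ℝ)).smul_const x
    have h4 : HasFDerivAt F (fderiv ℝ F x) ((1 : ℝ) • x) := by
      rw [one_smul]; exact hF.hasFDerivAt hx
    exact h4.comp_hasDerivAt (1 : ℝ) h3
  have h2 : HasDerivAt (fun t : ℝ => F x - ν * Real.log t) (-ν) 1 := by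
    simpa using ((Real.hasDerivAt_log one_ne_zero).const_mul ν).const_sub (F x)
  refine h1.unique (h2.congr_of_eventuallyEq ?_)
  filter_upwards [eventually_gt_nhds one_pos] with t ht
  exact hF.log_homogeneous x hx t ht

lemma hess_self (hF : IsRegularBarrier K F ν) {x : V} (hx : x ∈ interior (K : Set V)) :
    hess F x x = -fderiv ℝ F x := by
  have h1 : HasDerivAt (fun t : ℝ => fderiv ℝ F (t • x)) (hess F x x) 1 := by
    have h3 : HasDerivAt (fun t : ℝ => t • x) x 1 := by
      simpa using (hasDerivAt_id (1 : ℝ)).smul_const x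
    have h4 : HasFDerivAt (fderiv ℝ F) (hess F x) ((1 : ℝ) • x) := by
      rw [one_smul]; exact (hF.hasStrictFDerivAt_fderiv hx).hasFDerivAt
    exact h4.comp_hasDerivAt (1 : ℝ) h3
  have h2 : HasDerivAt (fun t : ℝ => t⁻¹ • fderiv ℝ F x) (-fderiv ℝ F x) 1 := by
    simpa using (hasDerivAt_inv (one_ne_zero (α := ℝ))).smul_const (fderiv ℝ F x)
  refine h1.unique (h2.congr_of_eventuallyEq ?_)
  filter_upwards [eventually_gt_nhds one_pos] with t ht
  exact hF.fderiv_smul hx ht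

end IsRegularBarrier

end Barrier

/-! ### The dual barrier -/

namespace ConicProblem

variable {E : Type*} [NormedAddCommGroup E] [NormedSpace ℝ E] [FiniteDimensional ℝ E] {m : ℕ}
  {P : ConicProblem E m} {F : E → ℝ} {ν : ℝ}

lemma mem_dualCone {s : StrongDual ℝ E} : s ∈ P.dualCone ↔ ∀ x ∈ P.cone, 0 ≤ s x :=
  ProperCone.mem_dual

lemma Standing.nonempty_interior (hP : P.Standing) : (interior (P.cone : Set E)).Nonempty :=
  let ⟨z, hz⟩ := hP.strict
  ⟨z.1, hz.1⟩

lemma model (hP : P.Standing) (hF : IsRegularBarrier P.cone F ν) :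
    SelfConcordantModel (interior (P.cone : Set E)) F (fderiv ℝ F) (hess F) :=
  hF.model hP.no_line

/-- Interior points of the dual cone are uniformly positive on the cone. -/
lemma exists_mul_norm_le {s : StrongDual ℝ E}
    (hs : s ∈ interior (P.dualCone : Set (StrongDual ℝ E))) :
    ∃ c : ℝ, 0 < c ∧ ∀ x ∈ P.cone, c * ‖x‖ ≤ s x := by
  obtain ⟨r, hr, hball⟩ := Metric.mem_nhds_iff.1 (mem_interior_iff_mem_nhds.1 hs)
  refine ⟨r / 2, by positivity, fun x hx => ?_⟩
  obtain ⟨l, hl, hlx⟩ := exists_dual_vector'' ℝ x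
  have hmem : s - (r / 2) • l ∈ P.dualCone := by
    refine hball ?_
    rw [Metric.mem_ball, dist_eq_norm, sub_sub_cancel_left, norm_neg, norm_smul, Real.norm_eq_abs,
      abs_of_pos (by positivity)]
    nlinarith
  have := mem_dualCone.1 hmem x hx
  simp only [sub_apply, smul_apply, smul_eq_mul] at this
  rw [hlx] at this
  simpa using this

lemma pos_of_mem_interior {s : StrongDual ℝ E}
    (hs : s ∈ interior (P.dualCone : Set (StrongDual ℝ E))) {x : E} (hx : x ∈ P.cone)
    (h0 : x ≠ 0) : 0 < s x := by
  obtain ⟨c, hc, hle⟩ := exists_mul_norm_le hs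
  have := hle x hx
  have := mul_pos hc (norm_pos_iff.2 h0)
  linarith

/-- The logarithmic growth of the barrier is dominated by a functional that is positive on the
cone. -/
lemma exists_lower_bound (hP : P.Standing) (hF : IsRegularBarrier P.cone F ν)
    {s : StrongDual ℝ E} (hs : s ∈ interior (P.dualCone : Set (StrongDual ℝ E))) :
    ∃ M : ℝ, ∀ x ∈ interior (P.cone : Set E), M ≤ F x + s x := by
  obtain ⟨c, hc, hle⟩ := exists_mul_norm_le hs
  obtain ⟨x₀, hx₀⟩ := hP.nonempty_interior
  have hν : 0 < ν := zero_lt_one.trans_le hF.one_le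
  refine ⟨F x₀ - fderiv ℝ F x₀ x₀ - ‖fderiv ℝ F x₀‖ + ν + ν * Real.log (c / ν), fun x hx => ?_⟩
  have hx0 : 0 < ‖x‖ := norm_pos_iff.2 (hF.ne_zero hx)
  have h1 := hF.log_homogeneous x hx ‖x‖⁻¹ (inv_pos.2 hx0)
  have h2 := hF.lower (h := ‖x‖⁻¹ • x - x₀) hx₀
    (by simpa using IsRegularBarrier.smul_mem_interior hx (inv_pos.2 hx0))
  have h3 := omegaLow_nonneg (localNorm_nonneg (hess F x₀) (‖x‖⁻¹ • x - x₀))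
  have h4 : -‖fderiv ℝ F x₀‖ ≤ fderiv ℝ F x₀ (‖x‖⁻¹ • x) := by
    have := (fderiv ℝ F x₀).le_opNorm (‖x‖⁻¹ • x)
    rw [norm_smul, norm_inv, norm_norm, inv_mul_cancel₀ hx0.ne', mul_one, Real.norm_eq_abs] at this
    exact (abs_le.1 this).1
  have h5 := Real.log_le_sub_one_of_pos (x := c / ν * ‖x‖) (by positivity)
  rw [Real.log_mul (by positivity) hx0.ne'] at h5
  have h6 := mul_le_mul_of_nonneg_left h5 hν.le
  have h7 : ν * (c / ν * ‖x‖ - 1) = c * ‖x‖ - ν := by field_simp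
  have h8 := hle x (interior_subset hx)
  rw [Real.log_inv] at h1
  rw [add_sub_cancel, map_sub] at h2
  linarith

/-- The maximizer `x(s)` in the definition of the dual barrier at `s`, characterized by
`∇F(x(s)) = -s`. -/
noncomputable def dualPoint (P : ConicProblem E m) (F : E → ℝ) (s : StrongDual ℝ E) : E :=
  Classical.epsilon fun x => x ∈ interior (P.cone : Set E) ∧ fderiv ℝ F x = -s

lemma dualPoint_spec (hP : P.Standing) (hF : IsRegularBarrier P.cone F ν)
    {s : StrongDual ℝ E} (hs : s ∈ interior (P.dualCone : Set (StrongDual ℝ E))) :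
    P.dualPoint F s ∈ interior (P.cone : Set E) ∧ fderiv ℝ F (P.dualPoint F s) = -s := by
  refine Classical.epsilon_spec
    (p := fun x => x ∈ interior (P.cone : Set E) ∧ fderiv ℝ F x = -s) ?_
  obtain ⟨M, hM⟩ := exists_lower_bound hP hF hs
  obtain ⟨x, hx, h0⟩ := ((model hP hF).add_linear s).exists_grad_eq_zero hP.nonempty_interior hM
  exact ⟨x, hx, eq_neg_of_add_eq_zero_left h0⟩

lemma dualPoint_eq (hP : P.Standing) (hF : IsRegularBarrier P.cone F ν)
    {s : StrongDual ℝ E} (hs : s ∈ interior (P.dualCone : Set (StrongDual ℝ E))) {x : E}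
    (hx : x ∈ interior (P.cone : Set E)) (h : fderiv ℝ F x = -s) : P.dualPoint F s = x :=
  let h1 := dualPoint_spec hP hF hs
  (model hP hF).eq_of_grad_eq h1.1 hx (h1.2.trans h.symm)

/-- The Fenchel dual form of the lower self-concordance bound. -/
lemma neg_sub_le (hP : P.Standing) (hF : IsRegularBarrier P.cone F ν) {s g : StrongDual ℝ E}
    {x x' : E} (hx : x ∈ interior (P.cone : Set E)) (hs : fderiv ℝ F x = -s)
    (hg : dualLocalNorm (hess F x) g < 1) (hx' : x' ∈ interior (P.cone : Set E)) :
    -((s + g) x') - F x' ≤ -(s x) - F x - g x + omegaStar (dualLocalNorm (hess F x) g) := by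
  have h1 := hF.lower (h := x' - x) hx (by simpa using hx')
  have h2 := abs_le.1 (((model hP hF).posDef x hx).abs_apply_le_dual g (x' - x))
  have h3 := mul_le_omegaLow_add_omegaStar (localNorm_nonneg (hess F x) (x' - x)) hg
  rw [hs, add_sub_cancel] at h1
  simp only [neg_apply, map_sub, add_apply] at h1 h2 ⊢
  linarith

lemma isGreatest_dualBarrier (hP : P.Standing) (hF : IsRegularBarrier P.cone F ν)
    {s : StrongDual ℝ E} {x : E} (hx : x ∈ interior (P.cone : Set E)) (hs : fderiv ℝ F x = -s) :
    IsGreatest (Set.range fun x' : interior (P.cone : Set E) => -(s x') - F x')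
      (-(s x) - F x) := by
  refine ⟨⟨⟨x, hx⟩, rfl⟩, ?_⟩
  rintro _ ⟨⟨x', hx'⟩, rfl⟩
  have := neg_sub_le hP hF (g := 0) hx hs (by simp [dualLocalNorm]) hx'
  simpa [dualLocalNorm, omegaStar] using this

lemma dualBarrier_eq (hP : P.Standing) (hF : IsRegularBarrier P.cone F ν)
    {s : StrongDual ℝ E} {x : E} (hx : x ∈ interior (P.cone : Set E)) (hs : fderiv ℝ F x = -s) :
    P.dualBarrier F s = -(s x) - F x :=
  (isGreatest_dualBarrier hP hF hx hs).csSup_eq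

lemma neg_sub_le_dualBarrier (hP : P.Standing) (hF : IsRegularBarrier P.cone F ν)
    {s : StrongDual ℝ E} (hs : s ∈ interior (P.dualCone : Set (StrongDual ℝ E))) {x : E}
    (hx : x ∈ interior (P.cone : Set E)) : -(s x) - F x ≤ P.dualBarrier F s := by
  have h1 := dualPoint_spec hP hF hs
  rw [dualBarrier_eq hP hF h1.1 h1.2]
  exact (isGreatest_dualBarrier hP hF h1.1 h1.2).2 ⟨⟨x, hx⟩, rfl⟩

/-- A functional at which the supremum defining the dual barrier is finite lies in the dual
cone. -/
lemma mem_dualCone_of_bounded (hP : P.Standing) (hF : IsRegularBarrier P.cone F ν)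
    {s : StrongDual ℝ E} {M : ℝ} (hM : ∀ x ∈ interior (P.cone : Set E), -(s x) - F x ≤ M) :
    s ∈ P.dualCone := by
  have hint : ∀ x ∈ interior (P.cone : Set E), 0 ≤ s x := by
    intro x hx
    by_contra! hneg
    set τ := max 1 ((M + F x + 1) / (-(s x))) with hτ
    have h1 : 1 ≤ τ := le_max_left _ _
    have h2 : (M + F x + 1) / (-(s x)) ≤ τ := le_max_right _ _
    rw [div_le_iff₀ (by linarith)] at h2
    have h3 := hM (τ • x) (IsRegularBarrier.smul_mem_interior hx (by linarith))
    rw [hF.log_homogeneous x hx τ (by linarith), map_smul, smul_eq_mul] at h3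
    have h4 := mul_nonneg (zero_le_one.trans hF.one_le) (Real.log_nonneg h1)
    linarith
  refine mem_dualCone.2 fun x hx => ?_
  have hcl : closure (interior (P.cone : Set E)) = P.cone := by
    rw [Convex.closure_interior_eq_closure_of_nonempty_interior P.cone.convex
      hP.nonempty_interior, P.cone.isClosed.closure_eq]
  have hx' : x ∈ closure (interior (P.cone : Set E)) := by rw [hcl]; exact hx
  exact closure_minimal (t := {x | 0 ≤ s x}) hint (isClosed_Ici.preimage s.continuous) hx'

/-- The dual barrier inherits the self-concordance bounds from the barrier by Fenchel duality; its
gradient at `s` is `-x(s)` and its Hessian is the inverse of `∇²F(x(s))`. -/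
lemma dualBarrier_model (hP : P.Standing) (hF : IsRegularBarrier P.cone F ν) :
    SelfConcordantModel (interior (P.dualCone : Set (StrongDual ℝ E))) (P.dualBarrier F)
      (fun s => evalDual E (-P.dualPoint F s))
      (fun s => dualForm (hess F (P.dualPoint F s))) := by
  have hdik : ∀ s ∈ interior (P.dualCone : Set (StrongDual ℝ E)), ∀ g,
      dualLocalNorm (hess F (P.dualPoint F s)) g < 1 → s + g ∈ P.dualCone := by
    intro s hs g hg
    obtain ⟨hx, hxs⟩ := dualPoint_spec hP hF hs
    exact mem_dualCone_of_bounded hP hF fun x' hx' => neg_sub_le hP hF hx hxs hg hx'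
  refine ⟨fun s hs => ?_, fun s hs g hg => ?_, fun s hs g hg => ?_, fun s hs g hg => ?_⟩
  · exact ((model hP hF).posDef _ (dualPoint_spec hP hF hs).1).dualForm
  · rw [localNorm_dualForm] at hg
    have hc : Continuous fun s' =>
        localNorm (dualForm (hess F (P.dualPoint F s))) (s' - s) := by
      unfold localNorm; fun_prop
    have ho : IsOpen {s' | localNorm (dualForm (hess F (P.dualPoint F s))) (s' - s) < 1} :=
      isOpen_Iio.preimage hc
    refine interior_maximal ?_ ho (by simpa [localNorm_dualForm] using hg)
    intro s' hs'
    have := hdik s hs (s' - s) hs'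
    simpa using this
  · obtain ⟨hx, hxs⟩ := dualPoint_spec hP hF hs
    rw [localNorm_dualForm] at hg ⊢
    have : Nonempty (interior (P.cone : Set E)) := ⟨⟨_, hx⟩⟩
    refine (ciSup_le fun x' => neg_sub_le hP hF hx hxs hg x'.2).trans ?_
    rw [dualBarrier_eq hP hF hx hxs]
    rw [evalDual_apply, map_neg]
    linarith
  · obtain ⟨hx, hxs⟩ := dualPoint_spec hP hF hs
    rw [localNorm_dualForm]
    set x := P.dualPoint F s with hxdef
    have hB := (model hP hF).posDef x hx
    set r := dualLocalNorm (hess F x) g with hr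
    have hr0 : 0 ≤ r := Real.sqrt_nonneg _
    have hp : 0 < 1 + r := by linarith
    -- the damped Newton step for the supremum at `s + g`, where the Fenchel inequality is tight
    set h := -((1 / (1 + r)) • (hess F x).inverse g) with hh
    have hn : localNorm (hess F x) h = r / (1 + r) := by
      rw [hh, localNorm_neg, localNorm_smul, hB.localNorm_inverse, ← hr,
        abs_of_pos (by positivity)]
      ring
    have hlt : localNorm (hess F x) h < 1 := by rw [hn, div_lt_one hp]; linarith
    have h1 := hF.upper hx hlt
    have h2 := neg_sub_le_dualBarrier hP hF hg (hF.dikin hx hlt)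
    have h3 : g h = -(r / (1 + r) * r) := by
      have : g ((hess F x).inverse g) = r ^ 2 := by
        rw [hr, ← hB.localNorm_inverse, hB.localNorm_sq, hB.apply_inverse]
      rw [hh, map_neg, map_smul, this, smul_eq_mul]
      ring
    rw [hn, omegaStar_div_one_add hr0, hxs] at h1
    rw [dualBarrier_eq hP hF hx hxs]
    rw [evalDual_apply, map_neg]
    simp only [neg_apply, add_apply, map_add] at h1 h2
    linarith

lemma hess_dualPoint (hP : P.Standing) (hF : IsRegularBarrier P.cone F ν)
    {s : StrongDual ℝ E} (hs : s ∈ interior (P.dualCone : Set (StrongDual ℝ E))) :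
    hess F (P.dualPoint F s) (P.dualPoint F s) = s := by
  obtain ⟨hx, hxs⟩ := dualPoint_spec hP hF hs
  rw [hF.hess_self hx, hxs, neg_neg]

lemma apply_dualPoint (hP : P.Standing) (hF : IsRegularBarrier P.cone F ν)
    {s : StrongDual ℝ E} (hs : s ∈ interior (P.dualCone : Set (StrongDual ℝ E))) :
    s (P.dualPoint F s) = ν := by
  obtain ⟨hx, hxs⟩ := dualPoint_spec hP hF hs
  have := hF.fderiv_self hx
  rw [hxs, neg_apply] at this
  linarith

lemma dualPoint_hasFDerivAt (hP : P.Standing) (hF : IsRegularBarrier P.cone F ν)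
    {s : StrongDual ℝ E} (hs : s ∈ interior (P.dualCone : Set (StrongDual ℝ E))) :
    HasFDerivAt (P.dualPoint F) (-(hess F (P.dualPoint F s)).inverse) s := by
  obtain ⟨hx, hxs⟩ := dualPoint_spec hP hF hs
  have hB := (model hP hF).posDef _ hx
  obtain ⟨e, he⟩ := hB.exists_equiv
  have hstr : HasStrictFDerivAt (fderiv ℝ F) (e : E →L[ℝ] StrongDual ℝ E) (P.dualPoint F s) := by
    rw [he]; exact hF.hasStrictFDerivAt_fderiv hx
  have h1 := hstr.to_localInverse.hasFDerivAt
  have himg : hstr.localInverse (fderiv ℝ F) e _ (fderiv ℝ F (P.dualPoint F s)) =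
    P.dualPoint F s := hstr.localInverse_apply_image
  have hr := hstr.eventually_right_inverse
  have hc := h1.continuousAt
  rw [hxs] at h1 hr himg hc
  have hneg : Tendsto (fun s' : StrongDual ℝ E => -s') (𝓝 s) (𝓝 (-s)) := continuous_neg.tendsto s
  have h2 : HasFDerivAt (fun s' => hstr.localInverse (fderiv ℝ F) e _ (-s'))
      ((e.symm : StrongDual ℝ E →L[ℝ] E).comp (-ContinuousLinearMap.id ℝ _)) s :=
    h1.comp s (hasFDerivAt_id s).neg
  refine (h2.congr_of_eventuallyEq ?_).congr_fderiv ?_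
  · have hin : ∀ᶠ s' in 𝓝 (-s), hstr.localInverse (fderiv ℝ F) e _ s' ∈
        interior (P.cone : Set E) :=
      hc.eventually (by rw [himg]; exact isOpen_interior.mem_nhds hx)
    filter_upwards [hneg.eventually hin, hneg.eventually hr, isOpen_interior.mem_nhds hs]
      with s' h3 h4 h5
    exact dualPoint_eq hP hF h5 h3 h4
  · rw [← he, ContinuousLinearMap.inverse_equiv]
    ext; simp

lemma fderiv_dualBarrier_hasFDerivAt (hP : P.Standing) (hF : IsRegularBarrier P.cone F ν)
    {s : StrongDual ℝ E} (hs : s ∈ interior (P.dualCone : Set (StrongDual ℝ E))) :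
    HasFDerivAt (fderiv ℝ (P.dualBarrier F)) (dualForm (hess F (P.dualPoint F s))) s := by
  have h1 := hasFDerivAt_clm_comp (Z := StrongDual ℝ (StrongDual ℝ E)) (evalDual E)
    (dualPoint_hasFDerivAt hP hF hs).fun_neg
  have h2 : HasFDerivAt (fderiv ℝ (P.dualBarrier F))
      ((evalDual E).comp (-(-(hess F (P.dualPoint F s)).inverse))) s := by
    refine h1.congr_of_eventuallyEq ?_
    filter_upwards [isOpen_interior.mem_nhds hs] with s' hs'
    exact ((dualBarrier_model hP hF).hasFDerivAt hs').fderiv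
  refine h2.congr_fderiv ?_
  ext g k
  exact congrArg k (neg_neg _)

lemma hess_dualBarrier (hP : P.Standing) (hF : IsRegularBarrier P.cone F ν)
    {s : StrongDual ℝ E} (hs : s ∈ interior (P.dualCone : Set (StrongDual ℝ E))) :
    hess (P.dualBarrier F) s = dualForm (hess F (P.dualPoint F s)) :=
  (fderiv_dualBarrier_hasFDerivAt hP hF hs).fderiv

/-- The Hessian of the dual barrier is homogeneous of degree `-2`. -/
lemma hess_dualBarrier_smul (hP : P.Standing) (hF : IsRegularBarrier P.cone F ν)
    {s : StrongDual ℝ E} (hs : s ∈ interior (P.dualCone : Set (StrongDual ℝ E))) {τ : ℝ}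
    (hτ : 0 < τ) (g k : StrongDual ℝ E) :
    hess (P.dualBarrier F) (τ • s) g k =
      (τ ^ 2)⁻¹ * k ((hess F (P.dualPoint F s)).inverse g) := by
  have hs' : τ • s ∈ interior (P.dualCone : Set (StrongDual ℝ E)) :=
    IsRegularBarrier.smul_mem_interior hs hτ
  obtain ⟨hx, hxs⟩ := dualPoint_spec hP hF hs
  have hx' := IsRegularBarrier.smul_mem_interior hx (inv_pos.2 hτ)
  have e : P.dualPoint F (τ • s) = τ⁻¹ • P.dualPoint F s := by
    refine dualPoint_eq hP hF hs' hx' ?_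
    rw [hF.fderiv_smul hx (inv_pos.2 hτ), hxs, inv_inv, smul_neg]
  have hB := (model hP hF).posDef _ hx
  have hB' := (model hP hF).posDef _ hx'
  have hinv : (hess F (τ⁻¹ • P.dualPoint F s)).inverse g =
      (τ ^ 2)⁻¹ • (hess F (P.dualPoint F s)).inverse g := by
    have : hess F (τ⁻¹ • P.dualPoint F s)
        ((τ ^ 2)⁻¹ • (hess F (P.dualPoint F s)).inverse g) = g := by
      rw [hF.hess_smul hx (inv_pos.2 hτ), smul_apply, map_smul, hB.apply_inverse, smul_smul,
        inv_pow, inv_inv, mul_inv_cancel₀ (by positivity), one_smul]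
    rw [← hB'.inverse_apply ((τ ^ 2)⁻¹ • (hess F (P.dualPoint F s)).inverse g), this]
  rw [hess_dualBarrier hP hF hs', dualForm_apply, e, hinv, map_smul, smul_eq_mul]

end ConicProblem

/-! ### The barrier of the dual feasible set -/

lemma hess_comp_affine {V W : Type*} [NormedAddCommGroup V] [NormedSpace ℝ V]
    [NormedAddCommGroup W] [NormedSpace ℝ W] {f : V → ℝ} {L : W →L[ℝ] V} {v : V} {w : W}
    {H : V →L[ℝ] StrongDual ℝ V} (h1 : ∀ᶠ x in 𝓝 (v + L w), DifferentiableAt ℝ f x)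
    (h2 : HasFDerivAt (fderiv ℝ f) H (v + L w)) :
    hess (fun w => f (v + L w)) w = H.bilinearComp L L := by
  have hL : ∀ z, HasFDerivAt (fun z => v + L z) L z := fun z => L.hasFDerivAt.const_add v
  have h3 : HasFDerivAt (fun z => fderiv ℝ f (v + L z)) (H.comp L) w := h2.comp w (hL w)
  have h4 := ((ContinuousLinearMap.compL ℝ W V ℝ).flip L).hasFDerivAt.comp w h3
  have h5 : HasFDerivAt (fderiv ℝ fun w => f (v + L w))
      (((ContinuousLinearMap.compL ℝ W V ℝ).flip L).comp (H.comp L)) w := by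
    refine h4.congr_of_eventuallyEq ?_
    filter_upwards [(hL w).continuousAt.eventually h1] with z hz
    exact (hz.hasFDerivAt.comp z (hL z)).fderiv
  rw [hess, h5.fderiv]
  ext h k
  rfl

namespace ConicProblem

variable {E : Type*} [NormedAddCommGroup E] [NormedSpace ℝ E] {m : ℕ}

/-- The adjoint operator `A^*` as a continuous linear map. -/
noncomputable def adjL (P : ConicProblem E m) :
    EuclideanSpace ℝ (Fin m) →L[ℝ] StrongDual ℝ E :=
  ((ContinuousLinearMap.compL ℝ E (EuclideanSpace ℝ (Fin m)) ℝ).flip P.A).comp (innerSL ℝ)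

lemma adjL_apply (P : ConicProblem E m) (y : EuclideanSpace ℝ (Fin m)) : P.adjL y = P.adj y := rfl

lemma adj_apply (P : ConicProblem E m) (y : EuclideanSpace ℝ (Fin m)) (x : E) :
    P.adj y x = ⟪y, P.A x⟫_ℝ := rfl

lemma slack_eq (P : ConicProblem E m) (y : EuclideanSpace ℝ (Fin m)) :
    P.slack y = P.c + (-P.adjL) y := by
  rw [slack, neg_apply, adjL_apply, sub_eq_add_neg]

lemma zeta_eq (P : ConicProblem E m) (F : E → ℝ) :
    P.zeta F = fun y => P.dualBarrier F (P.c + (-P.adjL) y) := by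
  funext y
  rw [zeta, slack_eq]

lemma psi_eq (P : ConicProblem E m) (F : E → ℝ) (t : ℝ) :
    P.psi F t = fun y => P.zeta F y + (-(t • innerSL ℝ P.b)) y := by
  funext y
  simp [psi, sub_eq_add_neg]

variable [FiniteDimensional ℝ E] {P : ConicProblem E m} {F : E → ℝ} {ν : ℝ}

/-- The interior `{y : c - A^* y ∈ int K^*}` of the dual feasible set. -/
def strictDual (P : ConicProblem E m) : Set (EuclideanSpace ℝ (Fin m)) :=
  {y | P.slack y ∈ interior (P.dualCone : Set (StrongDual ℝ E))}

lemma mem_dualFeasible_of_mem_strictDual {y : EuclideanSpace ℝ (Fin m)} (hy : y ∈ P.strictDual) :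
    y ∈ P.dualFeasible :=
  interior_subset (s := (P.dualCone : Set (StrongDual ℝ E))) hy

lemma Standing.adjL_injective (hP : P.Standing) : Function.Injective (-P.adjL) := by
  intro y y' h
  have h1 : P.adj y = P.adj y' := by
    rw [← adjL_apply, ← adjL_apply]
    simpa using h
  have := @hP.full_rank (y, 0) (y', 0) (by simp [h1])
  exact (Prod.mk.inj this).1

lemma hess_zeta (hP : P.Standing) (hF : IsRegularBarrier P.cone F ν)
    {y : EuclideanSpace ℝ (Fin m)} (hy : y ∈ P.strictDual) :
    hess (P.zeta F) y =
      (dualForm (hess F (P.dualPoint F (P.slack y)))).bilinearComp (-P.adjL) (-P.adjL) := by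
  have hs : P.slack y ∈ interior (P.dualCone : Set (StrongDual ℝ E)) := hy
  rw [zeta_eq]
  refine hess_comp_affine ?_ ?_
  · rw [← slack_eq]
    filter_upwards [isOpen_interior.mem_nhds hs] with s hs'
    exact ((dualBarrier_model hP hF).hasFDerivAt hs').differentiableAt
  · rw [← slack_eq]
    exact fderiv_dualBarrier_hasFDerivAt hP hF hs

lemma zeta_model (hP : P.Standing) (hF : IsRegularBarrier P.cone F ν) :
    SelfConcordantModel P.strictDual (P.zeta F) (fderiv ℝ (P.zeta F)) (hess (P.zeta F)) := by
  have h := (dualBarrier_model hP hF).comp_affine hP.adjL_injective P.c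
  have hU : {w | P.c + (-P.adjL) w ∈ interior (P.dualCone : Set (StrongDual ℝ E))} =
      P.strictDual := by
    ext y
    rw [Set.mem_ofPred_eq, ← slack_eq]
    rfl
  rw [hU, ← zeta_eq] at h
  refine h.congr (fun y hy => (h.hasFDerivAt hy).fderiv) fun y hy => ?_
  rw [hess_zeta hP hF hy, slack_eq]

lemma psi_model (hP : P.Standing) (hF : IsRegularBarrier P.cone F ν) (t : ℝ) :
    SelfConcordantModel P.strictDual (P.psi F t) (fderiv ℝ (P.psi F t)) (hess (P.zeta F)) := by
  have h := (zeta_model hP hF).add_linear (-(t • innerSL ℝ P.b))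
  rw [← psi_eq] at h
  exact h.congr (fun y hy => (h.hasFDerivAt hy).fderiv) fun y _ => rfl

/-- The Newton decrement is the local norm of the change of the slack along the Newton
direction. -/
lemma dualLocalNorm_adj_newtonDir (hP : P.Standing) (hF : IsRegularBarrier P.cone F ν) (t : ℝ)
    {y : EuclideanSpace ℝ (Fin m)} (hy : y ∈ P.strictDual) :
    dualLocalNorm (hess F (P.dualPoint F (P.slack y))) (P.adj (P.newtonDir F t y)) =
      P.newtonDec F t y := by
  rw [newtonDec, ← ((zeta_model hP hF).posDef y hy).localNorm_inverse, ← newtonDir,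
    hess_zeta hP hF hy, localNorm_bilinearComp, neg_apply, localNorm_neg, localNorm_dualForm,
    adjL_apply]

lemma exists_strict_primal (hP : P.Standing) :
    ∃ x ∈ interior (P.cone : Set E), P.A x = P.b :=
  let ⟨z, hz⟩ := hP.strict
  ⟨z.1, hz.1, hz.2.1⟩

lemma exists_mem_strictDual (hP : P.Standing) : P.strictDual.Nonempty := by
  obtain ⟨z, hz⟩ := hP.strict
  refine ⟨z.2.1, ?_⟩
  have : P.slack z.2.1 = z.2.2 := sub_eq_of_eq_add hz.2.2.2.symm
  change P.slack z.2.1 ∈ interior (P.dualCone : Set (StrongDual ℝ E))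
  rw [this]
  exact hz.2.2.1

/-- Strictly feasible primal points bound the penalty function from below. -/
lemma exists_psi_lower_bound (hP : P.Standing) (hF : IsRegularBarrier P.cone F ν) {t : ℝ}
    (ht : 0 < t) : ∃ M : ℝ, ∀ y ∈ P.strictDual, M ≤ P.psi F t y := by
  obtain ⟨x, hx, hAx⟩ := exists_strict_primal hP
  refine ⟨-(t * P.c x) - F (t • x), fun y hy => ?_⟩
  have h := neg_sub_le_dualBarrier hP hF hy (IsRegularBarrier.smul_mem_interior hx ht)
  rw [map_smul, slack, sub_apply, adj_apply, hAx, real_inner_comm, smul_eq_mul, mul_sub] at h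
  rw [psi, zeta, slack]
  linarith

theorem existsUnique_isAnalyticCenter (hP : P.Standing) (hF : IsRegularBarrier P.cone F ν)
    (hbdd : Bornology.IsBounded P.dualFeasible) :
    ∃! y : EuclideanSpace ℝ (Fin m), P.IsAnalyticCenter F y := by
  obtain ⟨x, hx, hAx⟩ := exists_strict_primal hP
  obtain ⟨R, hR⟩ := hbdd.exists_norm_le
  have hM : ∀ y ∈ P.strictDual, -P.c x - R * ‖P.b‖ - F x ≤ P.zeta F y := by
    intro y hy
    have h := neg_sub_le_dualBarrier hP hF hy hx
    rw [slack, sub_apply, adj_apply, hAx] at h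
    have h1 := abs_le.1 (abs_real_inner_le_norm y P.b)
    have h2 := mul_le_mul_of_nonneg_right (hR y (mem_dualFeasible_of_mem_strictDual hy))
      (norm_nonneg P.b)
    rw [zeta, slack]
    linarith
  obtain ⟨y, hy, h0⟩ := (zeta_model hP hF).exists_grad_eq_zero (exists_mem_strictDual hP) hM
  refine ⟨y, ⟨hy, h0⟩, fun y' hy' => ?_⟩
  exact (zeta_model hP hF).eq_of_grad_eq hy'.1 hy (hy'.2.trans h0.symm)

lemma inner_le_primalValue (hP : P.Standing) {y : EuclideanSpace ℝ (Fin m)}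
    (hy : y ∈ P.dualFeasible) : ⟪P.b, y⟫_ℝ ≤ P.primalValue := by
  obtain ⟨x, hx, hAx⟩ := exists_strict_primal hP
  refine le_csInf ⟨_, x, ⟨interior_subset hx, hAx⟩, rfl⟩ ?_
  rintro _ ⟨x, ⟨hx, hAx⟩, rfl⟩
  have := mem_dualCone.1 hy x hx
  rw [slack, sub_apply, adj_apply, hAx, real_inner_comm] at this
  linarith

lemma dualLocalNorm_b_pos (hP : P.Standing) (hF : IsRegularBarrier P.cone F ν)
    {y : EuclideanSpace ℝ (Fin m)} (hy : y ∈ P.strictDual) :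
    0 < dualLocalNorm (hess (P.zeta F) y) (innerSL ℝ P.b) := by
  rw [← localNorm_dualForm]
  refine ((zeta_model hP hF).posDef y hy).dualForm.localNorm_pos fun h => hP.b_ne ?_
  simpa using congrArg (fun l : StrongDual ℝ (EuclideanSpace ℝ (Fin m)) => l P.b) h

/-- The Dikin ellipsoid at `y` is dual feasible, so the maximum of `b` over it is at most the
optimal value. -/
lemma dualLocalNorm_b_le (hP : P.Standing) (hF : IsRegularBarrier P.cone F ν)
    {y : EuclideanSpace ℝ (Fin m)} (hy : y ∈ P.strictDual) :
    dualLocalNorm (hess (P.zeta F) y) (innerSL ℝ P.b) ≤ P.primalValue - ⟪P.b, y⟫_ℝ := by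
  have hB := (zeta_model hP hF).posDef y hy
  have hbpos := dualLocalNorm_b_pos hP hF hy
  set H := hess (P.zeta F) y
  set n := dualLocalNorm H (innerSL ℝ P.b) with hn
  have key : ∀ ρ : ℝ, 0 ≤ ρ → ρ < 1 → ρ * n ≤ P.primalValue - ⟪P.b, y⟫_ℝ := by
    intro ρ h0 h1
    have hin : localNorm H ((ρ / n) • H.inverse (innerSL ℝ P.b)) < 1 := by
      rw [localNorm_smul, hB.localNorm_inverse, ← hn, abs_of_nonneg (by positivity),
        div_mul_cancel₀ _ hbpos.ne']
      exact h1
    have h2 := inner_le_primalValue hP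
      (mem_dualFeasible_of_mem_strictDual ((zeta_model hP hF).dikin y hy _ hin))
    have h3 : ⟪P.b, H.inverse (innerSL ℝ P.b)⟫_ℝ = n ^ 2 := by
      rw [hn, ← hB.localNorm_inverse, hB.localNorm_sq, hB.apply_inverse]
      rfl
    rw [inner_add_right, inner_smul_right, h3] at h2
    have : ρ / n * n ^ 2 = ρ * n := by field_simp
    linarith
  refine le_of_forall_pos_lt_add fun e he => ?_
  -- choose `ρ = 1 - e / (n + e)`, so that the loss `(1 - ρ) n` is below `e`
  have hne : 0 < n + e := by linarith
  have h1 : e / (n + e) ≤ 1 := (div_le_one hne).2 (by linarith)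
  have h2 : 0 < e / (n + e) := by positivity
  have h3 := key (1 - e / (n + e)) (by linarith) (by linarith)
  have h4 : e / (n + e) * n < e := by
    rw [div_mul_eq_mul_div, div_lt_iff₀ hne]
    nlinarith
  linarith

/-- The local norm of `b` at an approximate analytic center is controlled by the gap at the exact
one. -/
lemma one_sub_mul_dualLocalNorm_b_le (hP : P.Standing) (hF : IsRegularBarrier P.cone F ν)
    {y ystar : EuclideanSpace ℝ (Fin m)} (hy : y ∈ P.strictDual)
    (hstar : P.IsAnalyticCenter F ystar) {β : ℝ} (hβ : 0 < β) (hβ' : β ≤ 1 / 4)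
    (hdec : dualLocalNorm (hess (P.zeta F) y) (fderiv ℝ (P.zeta F) y) ≤ β / 2) :
    (1 - β) * dualLocalNorm (hess (P.zeta F) y) (innerSL ℝ P.b) ≤
      P.primalValue - ⟪P.b, ystar⟫_ℝ := by
  have hB := (zeta_model hP hF).posDef y hy
  have h1 := (zeta_model hP hF).localNorm_sub_le_of_grad_eq_zero hy hstar.1 hstar.2
    (l := β / 2) (by linarith) (by linarith) hdec
  have h2 := dualLocalNorm_b_le hP hF hy
  have h3 := (abs_le.1 (hB.abs_apply_le_dual (innerSL ℝ P.b) (ystar - y))).2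
  rw [innerSL_apply_apply, inner_sub_right] at h3
  have h4 := mul_le_mul_of_nonneg_left h1 (dualLocalNorm_b_pos hP hF hy).le
  linarith

end ConicProblem

/-! ### The predictor step -/

lemma omegaStar_add_mul_one_sub {a b : ℝ} (ha : a < 1) (hb : b < 1) :
    omegaStar (a + b * (1 - a)) = omegaStar a + omegaStar b + a * b := by
  have e : 1 - (a + b * (1 - a)) = (1 - a) * (1 - b) := by ring
  unfold omegaStar
  rw [e, Real.log_mul (by linarith) (by linarith)]
  ring

/-- Bounds the proximity of `ẑ`, which is at most `β² + 2 ω_*(β)`, by the constant in the step size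
rule. -/
lemma sq_add_two_mul_omegaStar_le {β : ℝ} (hβ : 0 < β) (hβ' : β ≤ 1 / 4) :
    β ^ 2 + 2 * omegaStar β ≤ omegaStar (2 * β / (1 - β) ^ 2) := by
  have h1 : 0 < 1 - β := by linarith
  have h2 := omegaStar_le hβ.le (by linarith)
  have h3 : 2 * β / (1 - β) ^ 2 < 1 := by
    rw [div_lt_one (by positivity)]; nlinarith
  have h4 := half_sq_le_omegaStar (τ := 2 * β / (1 - β) ^ 2) (by positivity) h3
  have e : (2 * β / (1 - β) ^ 2) ^ 2 / 2 = 2 * β ^ 2 / (1 - β) ^ 4 := by field_simp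
  have h5 : β ^ 2 + 2 * (β ^ 2 / (2 * (1 - β))) ≤ 2 * β ^ 2 / (1 - β) ^ 4 := by
    have e2 : β ^ 2 + 2 * (β ^ 2 / (2 * (1 - β))) =
        β ^ 2 * (2 - β) * (1 - β) ^ 3 / (1 - β) ^ 4 := by
      field_simp; ring
    rw [e2]
    refine div_le_div_of_nonneg_right ?_ (by positivity)
    have h6 : (1 - β) ^ 3 ≤ 1 := pow_le_one₀ h1.le (by linarith)
    have : (2 - β) * (1 - β) ^ 3 ≤ 2 := by nlinarith [pow_pos h1 3]
    nlinarith [sq_nonneg β]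
  linarith

/-- A step of relative length `σ ≤ τ`, taken at local distance `l ≤ β` from the center. -/
lemma omegaStar_add_step_le {β τ σ l r : ℝ} (hβ : 0 < β) (hβ' : β < 1) (hl : 0 ≤ l)
    (hlβ : l ≤ β) (hτ : τ < 1) (hσ : 0 ≤ σ) (hστ : σ ≤ τ) (hr : r = σ * (1 - β)) :
    l + r < 1 ∧ omegaStar (l + r) ≤ omegaStar β + σ ^ 2 / (2 * (1 - τ)) + β * τ := by
  have h1 : 0 < 1 - β := by linarith
  have hr0 : 0 ≤ σ * (1 - β) := mul_nonneg hσ h1.le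
  have hb : β + σ * (1 - β) < 1 := by nlinarith
  have h2 : omegaStar (l + r) ≤ omegaStar (β + σ * (1 - β)) :=
    omegaStar_mono (by linarith) (by linarith) hb
  rw [omegaStar_add_mul_one_sub (by linarith) (by linarith)] at h2
  have h3 := omegaStar_le hσ (hστ.trans_lt hτ)
  have h4 : σ ^ 2 / (2 * (1 - σ)) ≤ σ ^ 2 / (2 * (1 - τ)) :=
    div_le_div_of_nonneg_left (by positivity) (by linarith) (by linarith)
  have h5 := mul_le_mul_of_nonneg_left hστ hβ.le
  exact ⟨by linarith, by linarith⟩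

/-- The lower bound on the predictor step size that follows from the growth estimate for the
proximity measure. -/
lemma step_size_ge {β δ w l α n₁ n₂ R a : ℝ} (hβ : 0 < β) (hβ' : β ≤ 1 / 4) (hδ : 0 < δ)
    (hw : 0 < w) (hl : 0 ≤ l) (hlβ : l ≤ β) (hα : 0 < α) (hn₁ : 0 ≤ n₁) (hn₂ : 0 ≤ n₂)
    (hR : 0 ≤ R) (hRw : R ≤ w + β) (hn : n₁ ^ 2 + n₂ ^ 2 = R ^ 2) (ha : |a| ≤ l * w)
    (hΩ : l + α * n₁ < 1 → l + α * n₂ < 1 → δ + omegaStar (2 * β / (1 - β) ^ 2) ≤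
      l ^ 2 - α * a + omegaStar (l + α * n₁) + omegaStar (l + α * n₂)) :
    (1 - β) / (w + β) * (δ / (1 + δ)) ≤ α := by
  have h1 : 0 < 1 - β := by linarith
  have hwβ : 0 < w + β := by linarith
  set τ := α * (w + β) / (1 - β) with hτ
  have hτ0 : 0 < τ := by positivity
  suffices h : δ / (1 + δ) ≤ τ by
    have := mul_le_mul_of_nonneg_left h (by positivity : 0 ≤ (1 - β) / (w + β))
    refine this.trans_eq ?_
    rw [hτ]; field_simp
  by_contra! hlt
  rw [lt_div_iff₀ (by linarith)] at hlt
  have hτ1 : τ < 1 := by nlinarith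
  have part : ∀ n, 0 ≤ n → n ≤ R → l + α * n < 1 ∧
      omegaStar (l + α * n) ≤ omegaStar β + (α * n / (1 - β)) ^ 2 / (2 * (1 - τ)) + β * τ := by
    intro n hn0 hnR
    refine omegaStar_add_step_le hβ (by linarith) hl hlβ hτ1 (by positivity) ?_ (by field_simp)
    rw [hτ]
    exact div_le_div_of_nonneg_right (mul_le_mul_of_nonneg_left (by linarith) hα.le) h1.le
  obtain ⟨p1, p2⟩ := part n₁ hn₁ (abs_le_of_sq_le_sq' (by nlinarith [sq_nonneg n₂]) hR).2
  obtain ⟨q1, q2⟩ := part n₂ hn₂ (abs_le_of_sq_le_sq' (by nlinarith [sq_nonneg n₁]) hR).2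
  have hmain := hΩ p1 q1
  have h3 := sq_add_two_mul_omegaStar_le hβ hβ'
  have h4 : l ^ 2 ≤ β ^ 2 := by gcongr
  have h5 : -(α * a) ≤ β * τ := by
    have e1 : -(α * a) ≤ α * (β * w) := by
      have := (abs_le.1 ha).1
      have : l * w ≤ β * w := by gcongr
      nlinarith
    have e2 : α * w ≤ τ := by
      rw [hτ, le_div_iff₀ h1]
      nlinarith [mul_pos hα hw, mul_pos hα hβ, mul_pos (mul_pos hα hw) hβ]
    nlinarith
  have h6 : (α * n₁ / (1 - β)) ^ 2 / (2 * (1 - τ)) + (α * n₂ / (1 - β)) ^ 2 / (2 * (1 - τ)) ≤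
      τ ^ 2 / (2 * (1 - τ)) := by
    have : 0 < 1 - τ := by linarith
    rw [← add_div]
    refine div_le_div_of_nonneg_right ?_ (by positivity)
    have e : (α * n₁ / (1 - β)) ^ 2 + (α * n₂ / (1 - β)) ^ 2 = (α * R / (1 - β)) ^ 2 := by
      rw [div_pow, div_pow, div_pow, mul_pow, mul_pow, mul_pow, ← hn]; ring
    rw [e, hτ]
    exact pow_le_pow_left₀ (by positivity) (div_le_div_of_nonneg_right
      (mul_le_mul_of_nonneg_left hRw hα.le) h1.le) 2
  have h7 : τ ^ 2 / (2 * (1 - τ)) + τ ≤ τ / (1 - τ) := by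
    have : 0 < 1 - τ := by linarith
    rw [← sub_nonneg]
    have e : τ / (1 - τ) - (τ ^ 2 / (2 * (1 - τ)) + τ) = τ ^ 2 / (2 * (1 - τ)) := by
      field_simp; ring
    rw [e]; positivity
  have h8 : δ ≤ τ / (1 - τ) := by
    have : β * τ ≤ 1 / 4 * τ := mul_le_mul_of_nonneg_right hβ' hτ0.le
    linarith
  rw [le_div_iff₀ (by linarith)] at h8
  nlinarith

/-- The growth of the penalty parameter in a predicting iteration. -/
lemma exp_rate_le {β δ ν α R : ℝ} (hβ : 0 < β) (hβ' : β ≤ 1 / 4) (hν : 1 ≤ ν) (hα1 : α < 1)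
    (hR : 0 < R) (hRw : R ≤ √ν + β) (hα : (1 - β) / (√ν + β) * (δ / (1 + δ)) ≤ α) :
    Real.exp ((1 - β) * kappa β δ / (√ν + β)) ≤ ν / ((1 - α) * R ^ 2) := by
  have hν0 : 0 < ν := by linarith
  set w := √ν with hw
  have hw1 : 1 ≤ w := Real.one_le_sqrt.2 hν
  have hsq : ν = w ^ 2 := (Real.sq_sqrt hν0.le).symm
  have h1 : 0 < 1 - α := by linarith
  have h1β : 0 < 1 - β := by linarith
  rw [← Real.le_log_iff_exp_le (by positivity), Real.log_div hν0.ne' (by positivity),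
    Real.log_mul h1.ne' (by positivity), hsq, Real.log_pow, Real.log_pow]
  have h2 := Real.log_le_sub_one_of_pos h1
  have h3 := Real.log_le_log hR hRw
  have h4 := log_le_half_sub_inv (u := (w + β) / w)
    (by rw [le_div_iff₀ (by linarith)]; linarith)
  rw [Real.log_div (by linarith) (by linarith), inv_div] at h4
  have h5 : (w + β) / w - w / (w + β) ≤ β * (2 + β) / (w + β) := by
    rw [div_sub_div _ _ (by linarith) (by linarith),
      div_le_div_iff₀ (by positivity) (by positivity)]
    have : 0 ≤ (w + β) * (β ^ 2 * (w - 1)) :=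
      mul_nonneg (by linarith) (mul_nonneg (by positivity) (by linarith))
    nlinarith
  have h6 : (1 - β) * kappa β δ / (w + β) =
      (1 - β) / (w + β) * (δ / (1 + δ)) - β * (2 + β) / (w + β) := by
    unfold kappa
    have : w + β ≠ 0 := by linarith
    field_simp
  push_cast
  linarith

namespace IsPosDefForm

variable {V : Type*} [NormedAddCommGroup V] [NormedSpace ℝ V] [FiniteDimensional ℝ V]
  {B : V →L[ℝ] StrongDual ℝ V}

lemma dual_symm (hB : IsPosDefForm B) (g k : StrongDual ℝ V) : g (B.inverse k) = k (B.inverse g) :=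
  hB.dualForm.symm k g

lemma dualLocalNorm_sq (hB : IsPosDefForm B) (g : StrongDual ℝ V) :
    dualLocalNorm B g ^ 2 = g (B.inverse g) :=
  hB.dualForm.localNorm_sq g

lemma dualLocalNorm_add_le (hB : IsPosDefForm B) (g k : StrongDual ℝ V) :
    dualLocalNorm B (g + k) ≤ dualLocalNorm B g + dualLocalNorm B k :=
  hB.dualForm.localNorm_add_le g k

variable {x q : V} {s u e : StrongDual ℝ V}

lemma dualLocalNorm_sub_sq (hB : IsPosDefForm B) (hx : B x = s) :
    dualLocalNorm B (s - u) ^ 2 = s x - 2 * u x + dualLocalNorm B u ^ 2 := by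
  have hs : B.inverse s = x := by rw [← hx, hB.inverse_apply]
  have h1 := hB.dual_symm s u
  rw [hs] at h1
  rw [hB.dualLocalNorm_sq, hB.dualLocalNorm_sq, map_sub, hs]
  simp only [sub_apply, map_sub, h1]
  ring

/-- The primal and dual parts of the affine-scaling direction are orthogonal. -/
lemma scaling_sq_add_sq (hB : IsPosDefForm B) (heq : e q = 0)
    (hq : q + B.inverse e = -B.inverse (s - u)) :
    localNorm B q ^ 2 + dualLocalNorm B e ^ 2 = dualLocalNorm B (s - u) ^ 2 := by
  have hBq : B q + e = -(s - u) := by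
    have := congrArg B hq
    rwa [map_add, map_neg, hB.apply_inverse, hB.apply_inverse] at this
  have h1 : s - u = -(B q + e) := by rw [hBq, neg_neg]
  have h2 : B q (B.inverse e) = 0 := by
    rw [hB.symm, hB.apply_inverse, heq]
  rw [hB.localNorm_sq, hB.dualLocalNorm_sq, hB.dualLocalNorm_sq, h1]
  simp only [map_neg, map_add, neg_apply, add_apply, hB.inverse_apply, h2, heq]
  ring

/-- The gap decreases by the factor `1 - α` along the affine-scaling direction. -/
lemma scaling_gap (hB : IsPosDefForm B) (hx : B x = s) (heq : e q = 0)
    (hq : q + B.inverse e = -B.inverse (s - u)) (α : ℝ) :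
    (s - u + α • e) (x - B.inverse u + α • q) = (1 - α) * dualLocalNorm B (s - u) ^ 2 := by
  have hs : B.inverse s = x := by rw [← hx, hB.inverse_apply]
  have h1 : x - B.inverse u = B.inverse (s - u) := by rw [map_sub, hs]
  have h2 := congrArg (s - u) hq
  rw [map_add, map_neg, hB.dual_symm] at h2
  rw [h1, hB.dualLocalNorm_sq]
  simp only [add_apply, smul_apply, map_add, map_smul, smul_eq_mul, heq]
  linear_combination α * h2

/-- The first-order change of the two barriers along the affine-scaling direction, up to sign. -/
lemma scaling_slope (hB : IsPosDefForm B) (hx : B x = s)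
    (hq : q + B.inverse e = -B.inverse (s - u)) : s q + e x = u x - s x := by
  have hs : B.inverse s = x := by rw [← hx, hB.inverse_apply]
  have h1 := hB.dual_symm s u
  have h3 := hB.dual_symm s e
  have h2 := congrArg s hq
  rw [hs] at h1 h3
  rw [map_add, map_neg, map_sub, map_sub, hs] at h2
  linarith

end IsPosDefForm

namespace ConicProblem

variable {E : Type*} [NormedAddCommGroup E] [NormedSpace ℝ E] [FiniteDimensional ℝ E] {m : ℕ}
  {P : ConicProblem E m} {F : E → ℝ} {ν : ℝ}

/-- Growth of the proximity measure along the affine-scaling direction, in the coordinates of the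
central point `x = x(s)` and with the Hessian `B = ∇²F(x)`. Both barriers are expanded at `x` and
`s` directly; the first-order terms cancel against the logarithm of the gap. -/
lemma Omega_predictor_le (hP : P.Standing) (hF : IsRegularBarrier P.cone F ν)
    {s u e : StrongDual ℝ E} {q : E} {t α : ℝ}
    (hs : s ∈ interior (P.dualCone : Set (StrongDual ℝ E))) (ht : 0 < t) (hα0 : 0 < α)
    (hα1 : α < 1) (heq : e q = 0)
    (hq : q + (hess F (P.dualPoint F s)).inverse e =
      -(hess F (P.dualPoint F s)).inverse (s - u))
    (hR : 0 < dualLocalNorm (hess F (P.dualPoint F s)) (s - u))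
    {l : ℝ} (hl : dualLocalNorm (hess F (P.dualPoint F s)) u = l)
    (h1 : l + α * localNorm (hess F (P.dualPoint F s)) q < 1)
    (h2 : l + α * dualLocalNorm (hess F (P.dualPoint F s)) e < 1)
    {z : PDPoint E m} (hz1 : t • z.1 = P.dualPoint F s -
      (hess F (P.dualPoint F s)).inverse u + α • q) (hz2 : z.2.2 = s - u + α • e) :
    P.Omega F ν z ≤ l ^ 2 - α * u (P.dualPoint F s) +
      omegaStar (l + α * localNorm (hess F (P.dualPoint F s)) q) +
      omegaStar (l + α * dualLocalNorm (hess F (P.dualPoint F s)) e) := by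
  obtain ⟨hx, hxs⟩ := dualPoint_spec hP hF hs
  have hBx := hess_dualPoint hP hF hs
  have hsx := apply_dualPoint hP hF hs
  have hval := dualBarrier_eq hP hF hx hxs
  have hM := dualBarrier_model hP hF
  have hB := (model hP hF).posDef _ hx
  have hν : 0 < ν := zero_lt_one.trans_le hF.one_le
  have hup := hM.upper s hs (-u + α • e)
  rw [localNorm_dualForm, evalDual_apply] at hup
  set x := P.dualPoint F s with hxdef
  set B := hess F x with hBdef
  have hr1 : localNorm B (-B.inverse u + α • q) ≤ l + α * localNorm B q := by
    refine (hB.localNorm_add_le _ _).trans_eq ?_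
    rw [localNorm_neg, hB.localNorm_inverse, localNorm_smul, abs_of_pos hα0, hl]
  have hr2 : dualLocalNorm B (-u + α • e) ≤ l + α * dualLocalNorm B e := by
    refine (hB.dualLocalNorm_add_le _ _).trans_eq ?_
    rw [← localNorm_dualForm, localNorm_neg, localNorm_dualForm, hl, ← localNorm_dualForm B (α • e),
      localNorm_smul, abs_of_pos hα0, localNorm_dualForm]
  have hf1 := hF.upper hx (hr1.trans_lt h1)
  have hin := hF.dikin hx (hr1.trans_lt h1)
  have hf2 := hup (hr2.trans_lt h2)
  have ho1 := omegaStar_mono (localNorm_nonneg _ _) hr1 h1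
  have ho2 : omegaStar (dualLocalNorm B (-u + α • e)) ≤ _ := omegaStar_mono
    (Real.sqrt_nonneg _ : 0 ≤ dualLocalNorm B (-u + α • e)) hr2 h2
  have e1 : x + (-B.inverse u + α • q) = t • z.1 := by rw [hz1]; abel
  have e2 : s + (-u + α • e) = z.2.2 := by rw [hz2]; abel
  have hsBu : s (B.inverse u) = u x := by
    rw [hB.dual_symm, ← hBx, hB.inverse_apply]
  rw [e1, hxs, ← hBdef] at hf1
  rw [e1] at hin
  rw [e2, hval] at hf2
  simp only [neg_apply, map_add, map_neg, map_smul, smul_eq_mul, hsBu] at hf1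
  simp only [neg_apply, add_apply, smul_apply, map_neg, smul_eq_mul] at hf2
  have hFz : F z.1 = F (t • z.1) + ν * Real.log t := by
    have := hF.log_homogeneous _ hin t⁻¹ (inv_pos.2 ht)
    rw [smul_smul, inv_mul_cancel₀ ht.ne', one_smul, Real.log_inv] at this
    linarith
  have hgap : z.2.2 z.1 = (1 - α) * dualLocalNorm B (s - u) ^ 2 / t := by
    have := hB.scaling_gap hBx heq hq α
    rw [← hz1, ← hz2, map_smul, smul_eq_mul] at this
    rw [← this]; field_simp
  have hslope := hB.scaling_slope hBx hq
  have hsq := hB.dualLocalNorm_sub_sq (u := u) hBx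
  set R2 := dualLocalNorm B (s - u) ^ 2 with hR2
  have hR2pos : 0 < R2 := by positivity
  have hα' : 0 < 1 - α := by linarith
  have hlog1 := Real.log_le_sub_one_of_pos hα'
  have hlog2 := Real.log_le_sub_one_of_pos (div_pos hR2pos hν)
  rw [Real.log_div hR2pos.ne' hν.ne'] at hlog2
  have hm1 := mul_le_mul_of_nonneg_left hlog1 hν.le
  have hm2 := mul_le_mul_of_nonneg_left hlog2 hν.le
  have hm3 : ν * (R2 / ν - 1) = R2 - ν := by field_simp
  rw [Omega, hgap, hFz, Real.log_div (by positivity) ht.ne', Real.log_mul hα'.ne' hR2pos.ne']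
  rw [hl] at hsq
  rw [hsx] at hsq hf2 hslope
  have hα2 : α * (s q + e x) = α * (u x - ν) := by rw [hslope]
  linarith

end ConicProblem

namespace ConicProblem

variable {E : Type*} [NormedAddCommGroup E] [NormedSpace ℝ E] [FiniteDimensional ℝ E] {m : ℕ}
  {P : ConicProblem E m} {F : E → ℝ} {ν : ℝ}

/-- A predicting iteration multiplies the penalty parameter by at least the factor
`exp ((1 - β) ϰ / (√ν + β))`. -/
lemma mul_exp_rate_le (hP : P.Standing) (hF : IsRegularBarrier P.cone F ν) {β δ : ℝ}
    (hβ : 0 < β) (hβ' : β ≤ 1 / 4) (hδ : 0 < δ) {y : EuclideanSpace ℝ (Fin m)} {t α : ℝ}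
    {zh dz : PDPoint E m} (hy : y ∈ P.strictDual) (ht : 0 < t) (hdec : P.newtonDec F t y ≤ β)
    (hzy : zh.2.1 = y + P.newtonDir F t y) (hzs : zh.2.2 = P.slack zh.2.1)
    (hzx : ∀ u : StrongDual ℝ E,
      u zh.1 = hess (P.dualBarrier F) (√t • P.slack y) zh.2.2 u)
    (hdx : ∀ u : StrongDual ℝ E,
      u dz.1 + hess (P.dualBarrier F) (√t • P.slack y) dz.2.2 u = -u zh.1)
    (hA : P.A dz.1 = 0) (hds : dz.2.2 + P.adj dz.2.1 = 0) (hα : 0 < α)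
    (hfeas : P.StrictlyFeasible (zh + α • dz))
    (hΩ : P.Omega F ν (zh + α • dz) = δ + omegaStar (2 * β / (1 - β) ^ 2)) :
    t * Real.exp ((1 - β) * kappa β δ / (√ν + β)) ≤
      ν / (zh + α • dz).2.2 (zh + α • dz).1 := by
  have hs : P.slack y ∈ interior (P.dualCone : Set (StrongDual ℝ E)) := hy
  obtain ⟨hx, hxs⟩ := dualPoint_spec hP hF hs
  have hBx := hess_dualPoint hP hF hs
  have hsx := apply_dualPoint hP hF hs
  have hB := (model hP hF).posDef _ hx
  have hH := hess_dualBarrier_smul hP hF hs (Real.sqrt_pos.2 ht)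
  have hun := dualLocalNorm_adj_newtonDir hP hF t hy
  have hν : 0 < ν := zero_lt_one.trans_le hF.one_le
  have hOm := fun α0 α1 a b c d e f => Omega_predictor_le (u := P.adj (P.newtonDir F t y))
    (e := dz.2.2) (q := t • dz.1) (α := α) (z := zh + α • dz) hP hF hs ht α0 α1 a b c hun d e f
  rw [Real.sq_sqrt ht.le] at hH
  set s := P.slack y with hsdef
  set d := P.newtonDir F t y with hd
  set x := P.dualPoint F s with hxdef
  set B := hess F x with hBdef
  set u := P.adj d with hu
  set l := P.newtonDec F t y with hl
  have hl0 : 0 ≤ l := Real.sqrt_nonneg _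
  have hsh : zh.2.2 = s - u := by
    rw [hzs, hzy, hsdef, hu, slack, slack, ← adjL_apply, ← adjL_apply, ← adjL_apply, map_add]
    abel
  have hxh : t • zh.1 = B.inverse (s - u) := by
    refine (SeparatingDual.eq_iff_forall_dual_eq (R := ℝ)).2 fun g => ?_
    have := hzx g
    rw [hH, hsh] at this
    rw [map_smul, this, smul_eq_mul, ← mul_assoc, mul_inv_cancel₀ ht.ne', one_mul]
  have hq : t • dz.1 + B.inverse dz.2.2 = -B.inverse (s - u) := by
    refine (SeparatingDual.eq_iff_forall_dual_eq (R := ℝ)).2 fun g => ?_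
    have := hdx g
    rw [hH] at this
    rw [← hxh, map_add, map_neg, map_smul, map_smul, smul_eq_mul, smul_eq_mul]
    linear_combination t * this - g (B.inverse dz.2.2) * (mul_inv_cancel₀ ht.ne')
  have heq : dz.2.2 (t • dz.1) = 0 := by
    rw [eq_neg_of_add_eq_zero_left hds, neg_apply, map_smul, adj_apply, hA, inner_zero_right]
    simp
  have hs' : B.inverse s = x := by rw [← hBx, hB.inverse_apply]
  have hz1 : t • (zh + α • dz).1 = x - B.inverse u + α • (t • dz.1) := by
    rw [Prod.fst_add, Prod.smul_fst, smul_add, hxh, map_sub, hs', smul_comm]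
  have hz2 : (zh + α • dz).2.2 = s - u + α • dz.2.2 := by
    rw [Prod.snd_add, Prod.snd_add, hsh]; rfl
  have hgap := hB.scaling_gap hBx heq hq α
  rw [← hz1, ← hz2, map_smul, smul_eq_mul] at hgap
  have hzpos : 0 < (zh + α • dz).2.2 (zh + α • dz).1 :=
    pos_of_mem_interior hfeas.2.2.1 (interior_subset hfeas.1) (hF.ne_zero hfeas.1)
  set R := dualLocalNorm B (s - u) with hR
  have hR0 : 0 ≤ R := Real.sqrt_nonneg _
  have hprod : 0 < (1 - α) * R ^ 2 := by rw [← hgap]; positivity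
  have hRpos : 0 < R := by
    refine hR0.lt_of_ne fun h => ?_
    rw [← h] at hprod
    simp at hprod
  have hα1 : α < 1 := by
    have := pos_of_mul_pos_left hprod (sq_nonneg R)
    linarith
  have hsn : dualLocalNorm B s = √ν := by rw [dualLocalNorm, hs', hsx]
  have hRw : R ≤ √ν + β := by
    have := hB.dualLocalNorm_add_le s (-u)
    rw [← sub_eq_add_neg, hsn, ← localNorm_dualForm B (-u), localNorm_neg, localNorm_dualForm,
      hun] at this
    linarith
  have hux : |u x| ≤ l * √ν := by
    have := hB.abs_apply_le_dual u x
    rwa [hun, ← hs', hB.localNorm_inverse, hsn, hs'] at this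
  have hstep := step_size_ge hβ hβ' hδ (Real.sqrt_pos.2 hν) hl0 hdec hα
    (localNorm_nonneg B (t • dz.1)) (Real.sqrt_nonneg _ : 0 ≤ dualLocalNorm B dz.2.2) hR0 hRw
    (hB.scaling_sq_add_sq heq hq) hux fun h1 h2 => by
      rw [← hΩ]; exact hOm hα hα1 heq hq hRpos h1 h2 hz1 hz2
  have hrate := exp_rate_le hβ hβ' hF.one_le hα1 hRpos hRw hstep
  refine (mul_le_mul_of_nonneg_left hrate ht.le).trans_eq ?_
  rw [← hgap]
  field_simp

end ConicProblem

/-! ### Counting iterations -/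

namespace Trace

variable {E : Type*} [NormedAddCommGroup E] [NormedSpace ℝ E] {m : ℕ}

lemma predCount_succ_of_le {T : Trace E m} {P : ConicProblem E m} {F : E → ℝ} {β : ℝ} {k : ℕ}
    (h : T.lam P F k ≤ β) : T.predCount P F β (k + 1) = T.predCount P F β k + 1 := by
  unfold predCount
  rw [Finset.range_add_one, Finset.filter_insert, if_pos h, Finset.card_insert_of_notMem (by simp)]

lemma predCount_succ_of_lt {T : Trace E m} {P : ConicProblem E m} {F : E → ℝ} {β : ℝ} {k : ℕ}
    (h : β < T.lam P F k) : T.predCount P F β (k + 1) = T.predCount P F β k := by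
  unfold predCount
  rw [Finset.range_add_one, Finset.filter_insert, if_neg (not_le.2 h)]

lemma predCount_mono {T : Trace E m} {P : ConicProblem E m} {F : E → ℝ} {β : ℝ} :
    Monotone (T.predCount P F β) :=
  fun _ _ h => Finset.card_le_card (Finset.filter_subset_filter _ (Finset.range_mono h))

/-- The `N`-th predicting iteration among the first `n` iterations. -/
lemma exists_predCount_eq {T : Trace E m} {P : ConicProblem E m} {F : E → ℝ} {β : ℝ} {N n : ℕ}
    (hN : 1 ≤ N) (h : N ≤ T.predCount P F β n) :
    ∃ k < n, T.lam P F k ≤ β ∧ T.predCount P F β k + 1 = N := by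
  induction n with
  | zero => simp [predCount] at h; omega
  | succ n ih =>
    by_cases hc : N ≤ T.predCount P F β n
    · obtain ⟨k, hk, h1⟩ := ih hc
      exact ⟨k, by omega, h1⟩
    · rcases le_or_gt (T.lam P F n) β with h1 | h1
      · rw [predCount_succ_of_le h1] at h
        exact ⟨n, by omega, h1, by omega⟩
      · rw [predCount_succ_of_lt h1] at h
        exact absurd h hc

variable [FiniteDimensional ℝ E] {T : Trace E m} {P : ConicProblem E m} {F : E → ℝ}
  {ν β δ : ℝ} {y₀ : EuclideanSpace ℝ (Fin m)} {n : ℕ}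

/-- A correcting iteration stays in the domain and decreases the penalty function by `ω(λ)`. -/
lemma IsRun.correction (hT : T.IsRun P F ν β δ y₀ n) (hP : P.Standing)
    (hF : IsRegularBarrier P.cone F ν) {k : ℕ} (hk : k < n) (h : β < T.lam P F k)
    (hy : T.y k ∈ P.strictDual) :
    T.y (k + 1) ∈ P.strictDual ∧ T.t (k + 1) = T.t k ∧
      P.psi F (T.t k) (T.y (k + 1)) ≤ P.psi F (T.t k) (T.y k) - omegaLow (T.lam P F k) := by
  obtain ⟨h1, h2⟩ := hT.newton k hk h
  obtain ⟨h3, h4⟩ := (ConicProblem.psi_model hP hF (T.t k)).damped_step hy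
  rw [h1]
  exact ⟨h3, h2, h4⟩

lemma IsRun.prediction (hT : T.IsRun P F ν β δ y₀ n) (hP : P.Standing)
    (hF : IsRegularBarrier P.cone F ν) (hβ : 0 < β) (hβ' : β ≤ 1 / 4) (hδ : 0 < δ) {k : ℕ}
    (hk : k < n) (h : T.lam P F k ≤ β) (hy : T.y k ∈ P.strictDual) (ht : 0 < T.t k) :
    T.y (k + 1) ∈ P.strictDual ∧
      T.t k * Real.exp ((1 - β) * kappa β δ / (√ν + β)) ≤ T.t (k + 1) := by
  obtain ⟨g1, g2, g3⟩ := hT.gambit k hk h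
  obtain ⟨d1, d2, d3⟩ := hT.direction k hk h
  obtain ⟨s1, s2, s3⟩ := hT.step k hk h
  obtain ⟨u1, u2⟩ := hT.update k hk h
  refine ⟨?_, ?_⟩
  · have : P.slack (T.y (k + 1)) = (T.znext k).2.2 := by
      rw [u1]; exact sub_eq_of_eq_add s2.2.2.2.symm
    change P.slack (T.y (k + 1)) ∈ interior (P.dualCone : Set (StrongDual ℝ E))
    rw [this]
    exact s2.2.2.1
  · rw [u2]
    exact ConicProblem.mul_exp_rate_le hP hF hβ hβ' hδ hy ht h g1 g2 g3 d1 d2 d3 s1 s2 s3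

lemma IsRun.t_zero_pos (hT : T.IsRun P F ν β δ y₀ n) (hP : P.Standing)
    (hF : IsRegularBarrier P.cone F ν) (hβ : 0 < β) (hy₀ : y₀ ∈ P.strictDual) : 0 < T.t 0 := by
  have := ConicProblem.dualLocalNorm_b_pos hP hF hy₀
  rw [hT.t_zero]
  positivity

/-- The penalty parameter grows geometrically in the number of predicting iterations. -/
lemma IsRun.growth (hT : T.IsRun P F ν β δ y₀ n) (hP : P.Standing)
    (hF : IsRegularBarrier P.cone F ν) (hβ : 0 < β) (hβ' : β ≤ 1 / 4) (hδ : 0 < δ)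
    (hy₀ : y₀ ∈ P.strictDual) {k : ℕ} (hk : k ≤ n) :
    T.y k ∈ P.strictDual ∧
      T.t 0 * Real.exp ((1 - β) * kappa β δ / (√ν + β) * T.predCount P F β k) ≤ T.t k := by
  have ht0 := hT.t_zero_pos hP hF hβ hy₀
  induction k with
  | zero =>
    rw [hT.y_zero]
    exact ⟨hy₀, by simp [predCount]⟩
  | succ k ih =>
    obtain ⟨hy, ht⟩ := ih (by omega)
    have htk : 0 < T.t k := (mul_pos ht0 (Real.exp_pos _)).trans_le ht
    rcases le_or_gt (T.lam P F k) β with h | h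
    · obtain ⟨h1, h2⟩ := hT.prediction hP hF hβ hβ' hδ hk h hy htk
      refine ⟨h1, le_trans ?_ h2⟩
      rw [predCount_succ_of_le h, Nat.cast_succ, mul_add, mul_one, Real.exp_add, ← mul_assoc]
      exact mul_le_mul_of_nonneg_right ht (Real.exp_pos _).le
    · obtain ⟨h1, h2, -⟩ := hT.correction hP hF hk h hy
      rw [predCount_succ_of_lt h, h2]
      exact ⟨h1, ht⟩

/-- Correction phases are finite, because each correction decreases the penalty function, which is
bounded below, by at least `ω(β)`. -/
lemma IsRun.exists_prediction (hT : ∀ n, T.IsRun P F ν β δ y₀ n) (hP : P.Standing)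
    (hF : IsRegularBarrier P.cone F ν) (hβ : 0 < β) (hβ' : β ≤ 1 / 4) (hδ : 0 < δ)
    (hy₀ : y₀ ∈ P.strictDual) (n : ℕ) : ∃ k, n ≤ k ∧ T.lam P F k ≤ β := by
  by_contra! hc
  have hin : ∀ k, T.y k ∈ P.strictDual := fun k =>
    ((hT k).growth hP hF hβ hβ' hδ hy₀ le_rfl).1
  have htn : 0 < T.t n :=
    (mul_pos ((hT 0).t_zero_pos hP hF hβ hy₀) (Real.exp_pos _)).trans_le
      ((hT n).growth hP hF hβ hβ' hδ hy₀ le_rfl).2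
  obtain ⟨M, hM⟩ := ConicProblem.exists_psi_lower_bound hP hF htn
  have key : ∀ j : ℕ, T.t (n + j) = T.t n ∧
      P.psi F (T.t n) (T.y (n + j)) ≤ P.psi F (T.t n) (T.y n) - j * omegaLow β := by
    intro j
    induction j with
    | zero => simp
    | succ j ih =>
      have hlt := hc (n + j) (by omega)
      obtain ⟨-, h1, h2⟩ := (hT (n + j + 1)).correction hP hF (Nat.lt_succ_self _) hlt (hin _)
      rw [ih.1] at h1 h2
      have h3 := omegaLow_mono hβ.le hlt.le
      refine ⟨h1, ?_⟩
      rw [← add_assoc]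
      push_cast
      linarith [ih.2]
  obtain ⟨j, hj⟩ := exists_nat_gt ((P.psi F (T.t n) (T.y n) - M) / omegaLow β)
  rw [div_lt_iff₀ (omegaLow_pos hβ)] at hj
  have := (key j).2
  have := hM _ (hin (n + j))
  linarith

lemma IsRun.exists_le_predCount (hT : ∀ n, T.IsRun P F ν β δ y₀ n) (hP : P.Standing)
    (hF : IsRegularBarrier P.cone F ν) (hβ : 0 < β) (hβ' : β ≤ 1 / 4) (hδ : 0 < δ)
    (hy₀ : y₀ ∈ P.strictDual) (N : ℕ) : ∃ n, N ≤ T.predCount P F β n := by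
  induction N with
  | zero => exact ⟨0, Nat.zero_le _⟩
  | succ N ih =>
    obtain ⟨n, hn⟩ := ih
    obtain ⟨k, hk, h⟩ := IsRun.exists_prediction hT hP hF hβ hβ' hδ hy₀ n
    refine ⟨k + 1, ?_⟩
    rw [predCount_succ_of_le h]
    exact Nat.succ_le_succ (hn.trans (predCount_mono hk))

end Trace

/-- If the number of predicting iterations reaches the complexity bound, then the initial penalty
parameter has grown beyond `ν / ε`. -/
lemma div_le_mul_exp {ν β δ ε gap b N : ℝ} (hν : 1 ≤ ν) (hβ : 0 < β) (hβ' : β ≤ 1 / 4)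
    (hκ : 0 < kappa β δ) (hε : 0 < ε) (hb : 0 < b) (hgap : (1 - β) * b ≤ gap)
    (hN : predBound ν β δ ε gap ≤ N) :
    ν / ε ≤ β / (2 * b) * Real.exp ((1 - β) * kappa β δ / (√ν + β) * N) := by
  have h1 : 0 < 1 - β := by linarith
  have hw : 0 < √ν := Real.sqrt_pos.2 (by linarith)
  have hg : 0 < gap := (mul_pos h1 hb).trans_le hgap
  set r := (1 - β) * kappa β δ / (√ν + β) with hr
  have hr0 : 0 < r := by positivity
  set a := 2 / ε * gap * ((β + √ν) ^ 2 / (β * (1 - β))) with ha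
  have ha0 : 0 < a := by positivity
  have h2 : Real.log a ≤ r * N := by
    have h3 : predBound ν β δ ε gap = r⁻¹ * Real.log a := by
      rw [predBound, hr, inv_div]
    rw [h3, inv_mul_le_iff₀ hr0] at hN
    exact hN
  have h3 : a ≤ Real.exp (r * N) := (Real.log_le_iff_le_exp ha0).1 h2
  refine le_trans ?_ (mul_le_mul_of_nonneg_left h3 (by positivity))
  have e : β / (2 * b) * a = gap / ((1 - β) * b) * ((β + √ν) ^ 2 / ε) := by
    rw [ha]; field_simp
  have h4 : ν ≤ (β + √ν) ^ 2 := by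
    have := Real.sq_sqrt (by linarith : (0 : ℝ) ≤ ν)
    nlinarith [mul_pos hβ hw]
  have h5 : 1 ≤ gap / ((1 - β) * b) := by rwa [le_div_iff₀ (by positivity), one_mul]
  have h6 : ν / ε ≤ (β + √ν) ^ 2 / ε := div_le_div_of_nonneg_right h4 hε.le
  rw [e]
  exact h6.trans (le_mul_of_one_le_left (by positivity) h5)

theorem corollary5p1 {E : Type*} [NormedAddCommGroup E] [NormedSpace ℝ E]
    [FiniteDimensional ℝ E] {m : ℕ} (P : ConicProblem E m) (hP : P.Standing)
    (F : E → ℝ) (ν : ℝ) (hF : IsRegularBarrier P.cone F ν)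
    (hbdd : Bornology.IsBounded P.dualFeasible)
    (β δ : ℝ) (hβ : 0 < β) (hβ' : β ≤ 1 / 4) (hδ : 0 < δ) (hκ : 0 < kappa β δ)
    (y₀ : EuclideanSpace ℝ (Fin m))
    (hy₀ : P.slack y₀ ∈ interior (P.dualCone : Set (StrongDual ℝ E)))
    (hy₀' : dualLocalNorm (hess (P.zeta F) y₀) (fderiv ℝ (P.zeta F) y₀) ≤ β / 2) :
    (∃! ystar : EuclideanSpace ℝ (Fin m), P.IsAnalyticCenter F ystar) ∧
    ∀ ystar : EuclideanSpace ℝ (Fin m), P.IsAnalyticCenter F ystar →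
    ∀ ε : ℝ, 0 < ε → ∀ T : Trace E m,
      (∀ n : ℕ, T.IsRun P F ν β δ y₀ n →
        max 1 ⌈predBound ν β δ ε (P.primalValue - ⟪P.b, ystar⟫_ℝ)⌉₊ ≤ T.predCount P F β n →
        ∃ k < n, T.lam P F k ≤ β ∧
          T.predCount P F β k <
            max 1 ⌈predBound ν β δ ε (P.primalValue - ⟪P.b, ystar⟫_ℝ)⌉₊ ∧
          (P.IsEpsSolution ε (T.zhat k) ∨ P.IsEpsSolution ε (T.znext k))) ∧
      ((∀ n : ℕ, T.IsRun P F ν β δ y₀ n) →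
        ∀ N : ℕ, ∃ n : ℕ, N ≤ T.predCount P F β n) := by
  refine ⟨ConicProblem.existsUnique_isAnalyticCenter hP hF hbdd,
    fun ystar hstar ε hε T => ⟨fun n hT hN => ?_,
      fun hT => Trace.IsRun.exists_le_predCount hT hP hF hβ hβ' hδ hy₀⟩⟩
  set N := max 1 ⌈predBound ν β δ ε (P.primalValue - ⟪P.b, ystar⟫_ℝ)⌉₊ with hNdef
  obtain ⟨k, hk, hlam, hcount⟩ := Trace.exists_predCount_eq (le_max_left _ _) hN
  refine ⟨k, hk, hlam, by omega, Or.inr ?_⟩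
  obtain ⟨-, hz, -⟩ := hT.step k hk hlam
  have hgrow := (hT.growth hP hF hβ hβ' hδ hy₀ hk).2
  rw [Trace.predCount_succ_of_le hlam, hcount, hT.t_zero, (hT.update k hk hlam).2] at hgrow
  have hlarge := div_le_mul_exp (N := N) hF.one_le hβ hβ' hκ hε
    (ConicProblem.dualLocalNorm_b_pos hP hF hy₀)
    (ConicProblem.one_sub_mul_dualLocalNorm_b_le hP hF hy₀ hstar hβ hβ' hy₀')
    ((Nat.le_ceil _).trans (Nat.cast_le.2 (le_max_right 1 _)))
  have hpos : 0 < (T.znext k).2.2 (T.znext k).1 :=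
    ConicProblem.pos_of_mem_interior hz.2.2.1 (interior_subset hz.1) (hF.ne_zero hz.1)
  have hν : 0 < ν := zero_lt_one.trans_le hF.one_le
  have hle : (T.znext k).2.2 (T.znext k).1 ≤ ε :=
    (div_le_div_iff_of_pos_left hν hε hpos).1 (hlarge.trans hgrow)
  refine ⟨⟨interior_subset hz.1, hz.2.1, interior_subset hz.2.2.1, hz.2.2.2⟩, ?_⟩
  have hgap := congrArg (fun l : StrongDual ℝ E => l (T.znext k).1) hz.2.2.2
  simp only [add_apply, ConicProblem.adj_apply, hz.2.1] at hgap
  rw [← hgap, real_inner_comm]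
  linarith
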